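/- Let $A,\bar A,B,\bar B$ be finite-dimensional quantum systems, let $\rho_{\rm in}$ be a density operator on $A\otimes\bar A$, and let $U:A\otimes\bar A\to B\otimes\bar B$ be unitary (the time evolution). Put $\rho_{B,0}=\mathrm{Tr}_{\bar B}\,U\rho_{\rm in}U^\dagger$. Write $S(\rho|\sigma)=\mathrm{Tr}(\rho\log\rho-\rho\log\sigma)$ for the relative entropy (natural logarithm; $S(\rho|\sigma)=+\infty$ unless $\ker\sigma\subseteq\ker\rho$). For $N\ge 1$, a finite-dimensional ancilla $W$, a unitary $V$ on $A^{\otimes N}\otimes W$ (acting as the identity on $\bar A^{\otimes N}$) and a unit vector $\psi\in W$, let $$\rho_{B^NW}=\mathrm{Tr}_{\bar B^{N}}\Big[U^{\otimes N}V\big(\rho_{\rm in}^{\otimes N}\otimes|\psi\rangle\langle\psi|\big)V^\dagger (U^{\otimes N})^\dagger\Big],\qquad \rho_W=\mathrm{Tr}_{B^N}\rho_{B^NW},$$ and define the space-time mutual information $$J_N(A:B)=\frac1N\sup_{W,V,\psi}S\big(\rho_{B^NW}\,\big|\,\rho_{B,0}^{\otimes N}\otimes\rho_W\big)\in[0,+\infty].$$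 Let $\mathcal O_A$ and $\mathcal O_B$ be nonzero Hermitian operators on $A$ and $B$, regarded also as operators $\mathcal O_A\otimes 1_{\bar A}$ and $\mathcal O_B\otimes 1_{\bar B}$, let $\mathcal O_B(t)=U^\dagger(\mathcal O_B\otimes 1_{\bar B})U$, and let $\|\cdot\|_\infty$ be the operator norm. Then for every $N\ge1$ $$J_N(A:B)\ \ge\ \frac18\left(\frac{-i\,\mathrm{Tr}\,\rho_{\rm in}[\mathcal O_B(t),\mathcal O_A]}{\|\mathcal O_A\|_\infty\|\mathcal O_B\|_\infty}\right)^2,$$ $$J_N(A:B)\ \ge\ \frac18\left(\frac{\mathrm{Tr}\,\rho_{\rm in}\{\mathcal O_B(t),\mathcal O_A\}-2\,\mathrm{Tr}(\rho_{\rm in}\mathcal O_B(t))\,\mathrm{Tr}(\rho_{\rm in}\mathcal O_A)}{\|\mathcal O_A\|_\infty\|\mathcal O_B\|_\infty}\right)^2 .$$ Moreover, let $N=1$, $W=\mathbb C^3$ and $\psi=|0\rangle$. There is a unitary $V$ on $A\otimes W$ with $V(\varphi\otimes|0\rangle)=\sum_{i=0}^2X_i\varphi\otimes|i\rangle$ for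 all $\varphi\in A$, where $$X_0=\sqrt{\tfrac12}\,1,\qquad X_1=\sqrt{\tfrac12}\,\frac{\mathcal O_A}{\|\mathcal O_A\|_\infty},\qquad X_2=\sqrt{\tfrac12}\sqrt{1-\frac{\mathcal O_A^2}{\|\mathcal O_A\|_\infty^2}},$$ and for the resulting state $\rho_{BW}$ the mutual information $I(B:W)=S(\rho_{BW}|\rho_B\otimes\rho_W)$, with $\rho_B=\mathrm{Tr}_W\rho_{BW}$, satisfies $$I(B:W)\ \ge\ \frac18\left(\frac{-i\,\mathrm{Tr}\,\rho_{\rm in}[\mathcal O_B(t),\mathcal O_A]}{\|\mathcal O_A\|_\infty\|\mathcal O_B\|_\infty}\right)^2 .$$ -/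

import Mathlib

open scoped Matrix Kronecker ComplexOrder

/-! Finite-dimensional Hilbert spaces are represented by finite index types of orthonormal bases;
operators are complex matrices and `⊗ₖ` is the tensor product of operators. -/

namespace STMI

noncomputable section

set_option linter.unusedSectionVars false

/-- A density operator: positive semidefinite with unit trace. -/
def IsState {n : Type*} [Fintype n] (ρ : Matrix n n ℂ) : Prop :=
  ρ.PosSemidef ∧ ρ.trace = 1

/-- The operator norm with respect to the Euclidean norm. -/
def opNorm {n : Type*} [Fintype n] [DecidableEq n] (O : Matrix n n ℂ) : ℝ :=
  ‖Matrix.toEuclideanCLM (n := n) (𝕜 := ℂ) O‖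

/-- Partial trace over the second tensor factor. -/
def traceRight {m n : Type*} [Fintype n] (M : Matrix (m × n) (m × n) ℂ) : Matrix m m ℂ :=
  Matrix.of fun x y => ∑ z, M (x, z) (y, z)

/-- Partial trace over the first tensor factor. -/
def traceLeft {m n : Type*} [Fintype m] (M : Matrix (m × n) (m × n) ℂ) : Matrix n n ℂ :=
  Matrix.of fun x y => ∑ z, M (z, x) (z, y)

/-- The `N`-fold tensor power `M ⊗ ⋯ ⊗ M`. -/
def tensorPow {m n : Type*} (N : ℕ) (M : Matrix m n ℂ) :
    Matrix (Fin N → m) (Fin N → n) ℂ :=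
  Matrix.of fun x y => ∏ k, M (x k) (y k)

open Classical in
/-- Quantum relative entropy `S(ρ|σ) = tr (ρ log ρ - ρ log σ)` (natural logarithm), equal to `+∞`
unless `ker σ ⊆ ker ρ`. The functional calculus uses `Real.log 0 = 0`, i.e. the logarithms are
taken on the supports, which is the usual convention `0 log 0 = 0`. -/
def relEntropy {n : Type*} [Fintype n] [DecidableEq n] (ρ σ : Matrix n n ℂ) : EReal :=
  if ∀ v : n → ℂ, σ *ᵥ v = 0 → ρ *ᵥ v = 0 then
    (((ρ * cfc Real.log ρ - ρ * cfc Real.log σ).trace.re : ℝ) : EReal)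
  else ⊤

/-- Mutual information `S(ρ_XY | ρ_X ⊗ ρ_Y)` of a bipartite state. -/
def mutualInfo {m n : Type*} [Fintype m] [DecidableEq m] [Fintype n] [DecidableEq n]
    (ρ : Matrix (m × n) (m × n) ℂ) : EReal :=
  relEntropy ρ (traceRight ρ ⊗ₖ traceLeft ρ)

section Setup

variable {a a' b b' w : Type*} [Fintype a] [DecidableEq a] [Fintype a'] [DecidableEq a']
  [Fintype b] [DecidableEq b] [Fintype b'] [DecidableEq b'] [Fintype w] [DecidableEq w]

/-- The unperturbed final state `ρ_{B,0} = tr_{B̄} (U ρ_in U†)` of region `B`. -/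
def stateB0 (ρ : Matrix (a × a') (a × a') ℂ) (U : Matrix (b × b') (a × a') ℂ) :
    Matrix b b ℂ :=
  traceRight (U * ρ * Uᴴ)

/-- An operator on `A^N W`, acting as the identity on `Ā^N`. -/
def extendCoupling (N : ℕ) (a' : Type*) [DecidableEq a']
    (V : Matrix ((Fin N → a) × w) ((Fin N → a) × w) ℂ) :
    Matrix ((Fin N → a × a') × w) ((Fin N → a × a') × w) ℂ :=
  (V ⊗ₖ (1 : Matrix (Fin N → a') (Fin N → a') ℂ)).submatrix
    (fun p => ((fun k => (p.1 k).1, p.2), fun k => (p.1 k).2))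
    (fun p => ((fun k => (p.1 k).1, p.2), fun k => (p.1 k).2))

/-- The state `V (ρ_in^{⊗N} ⊗ |ψ⟩⟨ψ|) V†` of `(A Ā)^N W` after the coupling. -/
def coupledState (N : ℕ) (ρ : Matrix (a × a') (a × a') ℂ)
    (V : Matrix ((Fin N → a) × w) ((Fin N → a) × w) ℂ) (ψ : w → ℂ) :
    Matrix ((Fin N → a × a') × w) ((Fin N → a × a') × w) ℂ :=
  extendCoupling N a' V * (tensorPow N ρ ⊗ₖ Matrix.vecMulVec ψ (star ψ)) *
    (extendCoupling N a' V)ᴴ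

/-- The connected state `ρ_{B^N W}`: couple `A^N` to `W`, evolve with `U^{⊗N}`, trace out
`B̄^N`. -/
def stateBW (N : ℕ) (ρ : Matrix (a × a') (a × a') ℂ) (U : Matrix (b × b') (a × a') ℂ)
    (V : Matrix ((Fin N → a) × w) ((Fin N → a) × w) ℂ) (ψ : w → ℂ) :
    Matrix ((Fin N → b) × w) ((Fin N → b) × w) ℂ :=
  traceRight
    (((tensorPow N U ⊗ₖ (1 : Matrix w w ℂ)) * coupledState N ρ V ψ *
        (tensorPow N U ⊗ₖ (1 : Matrix w w ℂ))ᴴ).submatrix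
      (fun p : ((Fin N → b) × w) × (Fin N → b') => (fun k => (p.1.1 k, p.2 k), p.1.2))
      (fun p : ((Fin N → b) × w) × (Fin N → b') => (fun k => (p.1.1 k, p.2 k), p.1.2)))

/-- The space-time mutual information
`J_N(A:B) = (1/N) sup S(ρ_{B^N W} | ρ_{B,0}^{⊗N} ⊗ ρ_W)`, the supremum being over all
finite-dimensional ancillas `W`, unitaries `V` on `A^N W` and pure initial states `ψ` of `W`. -/
def stmi (N : ℕ) (ρ : Matrix (a × a') (a × a') ℂ) (U : Matrix (b × b') (a × a') ℂ) : EReal :=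
  ((1 / (N : ℝ) : ℝ) : EReal) *
    ⨆ (d : ℕ) (V : Matrix ((Fin N → a) × Fin d) ((Fin N → a) × Fin d) ℂ)
      (_ : V ∈ Matrix.unitaryGroup ((Fin N → a) × Fin d) ℂ)
      (ψ : Fin d → ℂ) (_ : star ψ ⬝ᵥ ψ = 1),
      relEntropy (stateBW N ρ U V ψ)
        (tensorPow N (stateB0 ρ U) ⊗ₖ traceLeft (stateBW N ρ U V ψ))

/-- `O_A` as an operator on `A Ā`. -/
def opA (a' : Type*) [DecidableEq a'] (OA : Matrix a a ℂ) : Matrix (a × a') (a × a') ℂ :=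
  OA ⊗ₖ (1 : Matrix a' a' ℂ)

/-- The Heisenberg operator `O_B(t) = U† (O_B ⊗ 1) U`. -/
def heisenbergB (U : Matrix (b × b') (a × a') ℂ) (OB : Matrix b b ℂ) :
    Matrix (a × a') (a × a') ℂ :=
  Uᴴ * (OB ⊗ₖ (1 : Matrix b' b' ℂ)) * U

/-- The retarded function `-i tr (ρ_in [O_B(t), O_A])`. -/
def retarded (ρ : Matrix (a × a') (a × a') ℂ) (U : Matrix (b × b') (a × a') ℂ)
    (OA : Matrix a a ℂ) (OB : Matrix b b ℂ) : ℂ :=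
  -Complex.I * (ρ * (heisenbergB U OB * opA a' OA - opA a' OA * heisenbergB U OB)).trace

/-- The connected symmetric function
`tr (ρ_in {O_B(t), O_A}) - 2 tr (ρ_in O_B(t)) tr (ρ_in O_A)`. -/
def symmetricConn (ρ : Matrix (a × a') (a × a') ℂ) (U : Matrix (b × b') (a × a') ℂ)
    (OA : Matrix a a ℂ) (OB : Matrix b b ℂ) : ℂ :=
  (ρ * (heisenbergB U OB * opA a' OA + opA a' OA * heisenbergB U OB)).trace
    - 2 * (ρ * heisenbergB U OB).trace * (ρ * opA a' OA).trace

/-- Traces of products of two Hermitian operators are real. -/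
theorem trace_mul_im {n : Type*} [Fintype n] {ρ H : Matrix n n ℂ} (hρ : ρ.IsHermitian)
    (hH : H.IsHermitian) : (ρ * H).trace.im = 0 := by
  have h : star (ρ * H).trace = (ρ * H).trace := by
    rw [← Matrix.trace_conjTranspose, Matrix.conjTranspose_mul, hρ.eq, hH.eq, Matrix.trace_mul_comm]
  exact Complex.conj_eq_iff_im.mp h

theorem opA_isHermitian {OA : Matrix a a ℂ} (h : OA.IsHermitian) :
    (opA a' OA).IsHermitian := by
  simp [opA, Matrix.IsHermitian, Matrix.conjTranspose_kronecker, h.eq]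

theorem heisenbergB_isHermitian (U : Matrix (b × b') (a × a') ℂ) {OB : Matrix b b ℂ}
    (h : OB.IsHermitian) : (heisenbergB U OB).IsHermitian := by
  simp [heisenbergB, Matrix.IsHermitian, Matrix.conjTranspose_kronecker, h.eq,
    Matrix.conjTranspose_mul, Matrix.mul_assoc]

/-- The retarded function of Hermitian operators is real. -/
theorem retarded_im {ρ : Matrix (a × a') (a × a') ℂ} (hρ : ρ.IsHermitian)
    (U : Matrix (b × b') (a × a') ℂ) {OA : Matrix a a ℂ} {OB : Matrix b b ℂ}
    (hA : OA.IsHermitian) (hB : OB.IsHermitian) : (retarded ρ U OA OB).im = 0 := by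
  have hX := opA_isHermitian (a' := a') hA
  have hY := heisenbergB_isHermitian U hB
  have : retarded ρ U OA OB = (ρ * (-Complex.I •
      (heisenbergB U OB * opA a' OA - opA a' OA * heisenbergB U OB))).trace := by
    rw [Matrix.mul_smul, Matrix.trace_smul, smul_eq_mul, retarded]
  rw [this]
  refine trace_mul_im hρ ?_
  simp only [Matrix.IsHermitian, Matrix.conjTranspose_smul, Matrix.conjTranspose_sub,
    Matrix.conjTranspose_mul, hX.eq, hY.eq]
  simp only [star_neg, RCLike.star_def, Complex.conj_I, neg_neg, smul_sub, neg_smul]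
  abel

/-- The connected symmetric function of Hermitian operators is real. -/
theorem symmetricConn_im {ρ : Matrix (a × a') (a × a') ℂ} (hρ : ρ.IsHermitian)
    (U : Matrix (b × b') (a × a') ℂ) {OA : Matrix a a ℂ} {OB : Matrix b b ℂ}
    (hA : OA.IsHermitian) (hB : OB.IsHermitian) : (symmetricConn ρ U OA OB).im = 0 := by
  have hX := opA_isHermitian (a' := a') hA
  have hY := heisenbergB_isHermitian U hB
  have h1 := trace_mul_im hρ hX
  have h2 := trace_mul_im hρ hY
  have h3 : (ρ * (heisenbergB U OB * opA a' OA + opA a' OA * heisenbergB U OB)).trace.im = 0 := by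
    refine trace_mul_im hρ ?_
    simp only [Matrix.IsHermitian, Matrix.conjTranspose_add, Matrix.conjTranspose_mul, hX.eq, hY.eq]
    rw [add_comm]
  simp [symmetricConn, h1, h2, h3]

/-- The operators `X_0 = √(1/2) 1`, `X_1 = √(1/2) O/‖O‖`, `X_2 = √(1/2) √(1 - O²/‖O‖²)` of the
control-`O` coupling. -/
def controlOp (O : Matrix a a ℂ) : Fin 3 → Matrix a a ℂ :=
  ![Real.sqrt (1 / 2) • (1 : Matrix a a ℂ),
    Real.sqrt (1 / 2) • ((opNorm O)⁻¹ • O),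
    Real.sqrt (1 / 2) • cfc Real.sqrt (1 - ((opNorm O) ^ 2)⁻¹ • (O * O))]

end Setup

end

end STMI

/-! Each bound comes from one explicit coupling and one observable. Let N copies of the
control-`O_A` unitary act independently, with W = (ℂ³)^N starting in |0…0⟩. The connected state is
then the tensor power of a one-copy state τ = `branchState` on B ⊗ ℂ³ (`stateBW_tensorPow`).
Relative entropy is additive on tensor powers, so the factor 1/N cancels and a one-copy bound
suffices (`le_relEntropy_tensorPow`).

On one copy, test τ against σ ⊗ τ_W with the observable O_B ⊗ (u|0⟩⟨1| + ū|1⟩⟨0|). The off-diagonal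
block pairs X₀ ∝ 1 with X₁ ∝ O_A, so the difference of expectations is 1/(2‖O_A‖) times a correlator
(`trace_branchState_sub_mul`). The phase u = -i gives the commutator and u = 1 the connected
anticommutator. The observable squares to at most ‖O_B‖², and Pinsker's inequality |Tr (ρ-σ)O|² ≤
2‖O‖² S(ρ|σ) (`pinsker_observable`) yields the constant (1/2)²/2 = 1/8.

Pinsker is proved without trace norms or monotonicity under channels. In eigenbases of ρ and σ with
overlap matrix G, the quantum relative entropy is the classical one of the distributions |G i j|² x
i and |G i j|² y j. A pointwise inequality for x log x and a weighted Cauchy–Schwarz inequality then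
finish. The same overlap description makes additivity a classical computation. -/

namespace STMI

open Matrix

set_option linter.unusedSectionVars false

/-! ### Unitary diagonalizations and the functional calculus -/

/-- `M = P diag(d) P†` with `P` unitary (between possibly different index types) and `d` real. -/
structure Diagonalizes {m n : Type*} [Fintype m] [DecidableEq m] [Fintype n] [DecidableEq n]
    (M : Matrix n n ℂ) (P : Matrix n m ℂ) (d : m → ℝ) : Prop where
  conjTranspose_mul : Pᴴ * P = 1
  mul_conjTranspose : P * Pᴴ = 1
  eq : M = P * diagonal (fun i => (d i : ℂ)) * Pᴴ

section Diagonalizes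

variable {l m n : Type*} [Fintype l] [DecidableEq l] [Fintype m] [DecidableEq m]
  [Fintype n] [DecidableEq n]

theorem diagonalizes_eigenvectorUnitary {M : Matrix n n ℂ} (hM : M.IsHermitian) :
    Diagonalizes M (hM.eigenvectorUnitary : Matrix n n ℂ) hM.eigenvalues where
  conjTranspose_mul := Unitary.coe_star_mul_self hM.eigenvectorUnitary
  mul_conjTranspose := Unitary.coe_mul_star_self hM.eigenvectorUnitary
  eq := by
    conv_lhs => rw [hM.spectral_theorem, Unitary.conjStarAlgAut_apply]
    rfl

theorem exists_diagonalizes {M : Matrix n n ℂ} (hM : M.IsHermitian) :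
    ∃ (P : Matrix n n ℂ) (d : n → ℝ), Diagonalizes M P d :=
  ⟨_, _, diagonalizes_eigenvectorUnitary hM⟩

namespace Diagonalizes

variable {M : Matrix n n ℂ} {P : Matrix n m ℂ} {d : m → ℝ}

theorem isHermitian (h : Diagonalizes M P d) : M.IsHermitian := by
  rw [IsHermitian, h.eq, Matrix.conjTranspose_mul, Matrix.conjTranspose_mul,
    conjTranspose_conjTranspose, diagonal_conjTranspose, Matrix.mul_assoc]
  congr 2
  congr 1
  ext i
  simp

/-- The unitary Rᴴ P relating P to the eigenbasis of the spectral theorem intertwines the two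
diagonal matrices. Its entries therefore vanish unless the eigenvalues agree, so it also intertwines
their images under any f, continuous or not. Hence any diagonalization may be used to compute
logarithms, in particular the product one of a tensor power. -/
theorem cfc_eq (h : Diagonalizes M P d) (f : ℝ → ℝ) :
    cfc f M = P * diagonal (fun i => (f (d i) : ℂ)) * Pᴴ := by
  have hM := h.isHermitian
  have h₀ := diagonalizes_eigenvectorUnitary hM
  rw [hM.cfc_eq, IsHermitian.cfc, Unitary.conjStarAlgAut_apply]
  set R : Matrix n n ℂ := (hM.eigenvectorUnitary : Matrix n n ℂ)
  set e := hM.eigenvalues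
  have key : diagonal (fun i => (e i : ℂ)) * (Rᴴ * P) =
      (Rᴴ * P) * diagonal (fun i => (d i : ℂ)) := by
    calc diagonal (fun i => (e i : ℂ)) * (Rᴴ * P)
        = (Rᴴ * R) * diagonal (fun i => (e i : ℂ)) * (Rᴴ * P) := by
          rw [h₀.conjTranspose_mul, Matrix.one_mul]
      _ = Rᴴ * (R * diagonal (fun i => (e i : ℂ)) * Rᴴ) * P := by
          simp only [Matrix.mul_assoc]
      _ = Rᴴ * (P * diagonal (fun i => (d i : ℂ)) * Pᴴ) * P := by rw [← h₀.eq, ← h.eq]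
      _ = (Rᴴ * P) * diagonal (fun i => (d i : ℂ)) * (Pᴴ * P) := by
          simp only [Matrix.mul_assoc]
      _ = _ := by rw [h.conjTranspose_mul, Matrix.mul_one]
  have key' : diagonal (fun i => (f (e i) : ℂ)) * (Rᴴ * P) =
      (Rᴴ * P) * diagonal (fun i => (f (d i) : ℂ)) := by
    ext i j
    have hij := congrFun (congrFun key i) j
    rw [diagonal_mul, mul_diagonal] at hij ⊢
    by_cases hz : (Rᴴ * P) i j = 0
    · simp [hz]
    · rw [mul_comm] at hij
      have : (e i : ℂ) = d j := mul_left_cancel₀ hz hij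
      have : e i = d j := by exact_mod_cast this
      rw [this, mul_comm]
  change R * diagonal (fun i => (f (e i) : ℂ)) * Rᴴ = _
  calc R * diagonal (fun i => (f (e i) : ℂ)) * Rᴴ
      = R * diagonal (fun i => (f (e i) : ℂ)) * Rᴴ * (P * Pᴴ) := by
        rw [h.mul_conjTranspose, Matrix.mul_one]
    _ = R * (diagonal (fun i => (f (e i) : ℂ)) * (Rᴴ * P)) * Pᴴ := by
        simp only [Matrix.mul_assoc]
    _ = (R * Rᴴ) * P * diagonal (fun i => (f (d i) : ℂ)) * Pᴴ := by
        rw [key']; simp only [Matrix.mul_assoc]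
    _ = _ := by rw [h₀.mul_conjTranspose, Matrix.one_mul]

theorem mul_eq {M' : Matrix n n ℂ} {d' : m → ℝ} (h : Diagonalizes M P d)
    (h' : Diagonalizes M' P d') : Diagonalizes (M * M') P (fun i => d i * d' i) where
  conjTranspose_mul := h.conjTranspose_mul
  mul_conjTranspose := h.mul_conjTranspose
  eq := by
    rw [h.eq, h'.eq]
    calc _ = P * diagonal (fun i => (d i : ℂ)) * (Pᴴ * P) *
          diagonal (fun i => (d' i : ℂ)) * Pᴴ := by simp only [Matrix.mul_assoc]
      _ = _ := by
        rw [h.conjTranspose_mul, Matrix.mul_one, Matrix.mul_assoc P, diagonal_mul_diagonal]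
        simp

theorem cfc (h : Diagonalizes M P d) (f : ℝ → ℝ) :
    Diagonalizes (cfc f M) P (fun i => f (d i)) :=
  ⟨h.conjTranspose_mul, h.mul_conjTranspose, h.cfc_eq f⟩

theorem one (h : Diagonalizes M P d) : Diagonalizes 1 P (fun _ => 1) :=
  ⟨h.conjTranspose_mul, h.mul_conjTranspose, by simp [h.mul_conjTranspose]⟩

theorem sub {M' : Matrix n n ℂ} {d' : m → ℝ} (h : Diagonalizes M P d)
    (h' : Diagonalizes M' P d') : Diagonalizes (M - M') P (fun i => d i - d' i) where
  conjTranspose_mul := h.conjTranspose_mul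
  mul_conjTranspose := h.mul_conjTranspose
  eq := by
    rw [h.eq, h'.eq, ← Matrix.sub_mul, ← Matrix.mul_sub, diagonal_sub]
    simp

theorem smul (h : Diagonalizes M P d) (c : ℝ) : Diagonalizes (c • M) P (fun i => c * d i) where
  conjTranspose_mul := h.conjTranspose_mul
  mul_conjTranspose := h.mul_conjTranspose
  eq := by
    rw [h.eq, ← Matrix.smul_mul, ← Matrix.mul_smul, ← diagonal_smul]
    congr 3
    ext i
    simp

theorem eigenvalue_nonneg (h : Diagonalizes M P d) (hM : M.PosSemidef) (i : m) : 0 ≤ d i := by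
  have h1 : Pᴴ * M * P = diagonal (fun i => (d i : ℂ)) := by
    rw [h.eq]
    calc _ = (Pᴴ * P) * diagonal (fun i => (d i : ℂ)) * (Pᴴ * P) := by
          simp only [Matrix.mul_assoc]
      _ = _ := by rw [h.conjTranspose_mul]; simp
  have h2 := (hM.conjTranspose_mul_mul_same P).diag_nonneg (i := i)
  rw [h1, diagonal_apply_eq] at h2
  exact_mod_cast h2

theorem trace_eq (h : Diagonalizes M P d) : M.trace = ((∑ i, d i : ℝ) : ℂ) := by
  rw [h.eq, trace_mul_comm, ← Matrix.mul_assoc, h.conjTranspose_mul]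
  simp [trace]

theorem sum_eigenvalues (h : Diagonalizes M P d) (hM : IsState M) : ∑ i, d i = 1 := by
  have := h.trace_eq
  rw [hM.2] at this
  exact_mod_cast this.symm

/-- Trace of a product in terms of the overlaps of two eigenbases. -/
theorem trace_mul {M' : Matrix n n ℂ} {Q : Matrix n l ℂ} {e : l → ℝ} (h : Diagonalizes M P d)
    (h' : Diagonalizes M' Q e) :
    (M * M').trace = ((∑ i, ∑ j, ‖(Pᴴ * Q) i j‖ ^ 2 * (d i * e j) : ℝ) : ℂ) := by
  have h1 : (M * M').trace = (diagonal (fun i => (d i : ℂ)) * (Pᴴ * Q) *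
      diagonal (fun i => (e i : ℂ)) * (Pᴴ * Q)ᴴ).trace := by
    rw [h.eq, h'.eq, Matrix.mul_assoc P, Matrix.mul_assoc P, trace_mul_comm P,
      Matrix.conjTranspose_mul, conjTranspose_conjTranspose]
    simp only [Matrix.mul_assoc]
  rw [h1, trace]
  push_cast
  refine Finset.sum_congr rfl fun i _ => ?_
  rw [diag_apply, mul_apply]
  refine Finset.sum_congr rfl fun j _ => ?_
  rw [mul_diagonal, diagonal_mul, conjTranspose_apply, ← Complex.mul_conj',
    RCLike.star_def]
  ring

/-- The squared overlaps of two orthonormal bases are doubly stochastic; here this is read off from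
`trace_mul` by letting Q diagonalize the identity. With its left counterpart it gives both overlap
distributions of a pair of states total mass one. -/
theorem sum_overlap_right {M' : Matrix n n ℂ} {Q : Matrix n l ℂ} {e : l → ℝ}
    (h : Diagonalizes M P d) (h' : Diagonalizes M' Q e) :
    ∑ i, ∑ j, ‖(Pᴴ * Q) i j‖ ^ 2 * d i = ∑ i, d i := by
  have h1 := h.trace_mul h'.one
  rw [Matrix.mul_one, h.trace_eq] at h1
  have h2 := Complex.ofReal_injective h1
  simpa using h2.symm

theorem sum_overlap_left {M' : Matrix n n ℂ} {Q : Matrix n l ℂ} {e : l → ℝ}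
    (h : Diagonalizes M P d) (h' : Diagonalizes M' Q e) :
    ∑ i, ∑ j, ‖(Pᴴ * Q) i j‖ ^ 2 * e j = ∑ j, e j := by
  have h1 := h.one.trace_mul h'
  rw [Matrix.one_mul, h'.trace_eq] at h1
  have h2 := Complex.ofReal_injective h1
  simpa using h2.symm

/-- The relative entropy as the classical relative entropy of the overlap distributions. -/
theorem trace_log {M' : Matrix n n ℂ} {Q : Matrix n l ℂ} {e : l → ℝ} (h : Diagonalizes M P d)
    (h' : Diagonalizes M' Q e) :
    (M * _root_.cfc Real.log M - M * _root_.cfc Real.log M').trace.re =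
      ∑ i, ∑ j, ‖(Pᴴ * Q) i j‖ ^ 2 * d i * (Real.log (d i) - Real.log (e j)) := by
  have h1 := (h.mul_eq (h.cfc Real.log)).trace_mul h'.one
  have h2 := h.trace_mul (h'.cfc Real.log)
  rw [Matrix.mul_one] at h1
  rw [trace_sub, h1, h2, ← Complex.ofReal_sub, Complex.ofReal_re, ← Finset.sum_sub_distrib]
  refine Finset.sum_congr rfl fun i _ => ?_
  rw [← Finset.sum_sub_distrib]
  refine Finset.sum_congr rfl fun j _ => ?_
  ring

/-- Absolute continuity of the overlap distributions. -/
theorem overlap_eq_zero {M' : Matrix n n ℂ} {Q : Matrix n l ℂ} {e : l → ℝ}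
    (h : Diagonalizes M P d) (h' : Diagonalizes M' Q e)
    (hker : ∀ v : n → ℂ, M' *ᵥ v = 0 → M *ᵥ v = 0) (i : m) (j : l) (hj : e j = 0) :
    ‖(Pᴴ * Q) i j‖ ^ 2 * d i = 0 := by
  have h1 : M' *ᵥ (Q *ᵥ Pi.single j 1) = 0 := by
    rw [h'.eq, mulVec_mulVec, Matrix.mul_assoc, h'.conjTranspose_mul, Matrix.mul_one,
      ← mulVec_mulVec, diagonal_mulVec_single, hj]
    simp
  have h2 := congrArg (fun v => (Pᴴ *ᵥ v) i) (hker _ h1)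
  have h3 : Pᴴ * M * Q = diagonal (fun i => (d i : ℂ)) * (Pᴴ * Q) := by
    rw [h.eq]
    calc _ = (Pᴴ * P) * diagonal (fun i => (d i : ℂ)) * (Pᴴ * Q) := by
          simp only [Matrix.mul_assoc]
      _ = _ := by rw [h.conjTranspose_mul, Matrix.one_mul]
  simp only [mulVec_mulVec] at h2
  rw [← Matrix.mul_assoc, h3] at h2
  simp only [mulVec_single_one, mulVec_zero, Pi.zero_apply, col_apply, diagonal_mul] at h2
  rcases mul_eq_zero.mp h2 with h4 | h4
  · rw [Complex.ofReal_eq_zero.mp h4, mul_zero]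
  · simp [h4]

end Diagonalizes

end Diagonalizes

/-! ### A Pinsker inequality for observables -/

/-- The difference of the two sides vanishes at 1 together with its first derivative, and its second
derivative 2(log x + 1/x - 1) is nonnegative. The first derivative thus changes sign at 1, where the
minimum lies. -/
theorem entropy_term_lower_bound_one {x : ℝ} (hx : 0 < x) :
    3 / 2 * (x - 1) ^ 2 ≤ (x + 2) * (x * Real.log x - x + 1) := by
  have hg : ∀ y : ℝ, 0 < y → HasDerivAt (fun y => 2 * (y + 1) * Real.log y - 4 * (y - 1))
      (2 * (Real.log y + y⁻¹ - 1)) y := by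
    intro y hy
    have h1 := (((hasDerivAt_id y).add_const 1).const_mul 2).mul (Real.hasDerivAt_log hy.ne')
    have h2 := ((hasDerivAt_id y).sub_const 1).const_mul 4
    refine (h1.sub h2).congr_deriv ?_
    simp only [id]
    field_simp
    ring
  have hh : ∀ y : ℝ, 0 < y → HasDerivAt
      (fun y => (y + 2) * (y * Real.log y - y + 1) - 3 / 2 * (y - 1) ^ 2)
      (2 * (y + 1) * Real.log y - 4 * (y - 1)) y := by
    intro y hy
    have h1 := ((hasDerivAt_id y).add_const 2).mul
      (((Real.hasDerivAt_mul_log hy.ne').sub (hasDerivAt_id y)).add_const 1)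
    have h2 := (((hasDerivAt_id y).sub_const 1).pow 2).const_mul (3 / 2)
    refine (h1.sub h2).congr_deriv ?_
    simp
    ring
  have gmono : MonotoneOn (fun y => 2 * (y + 1) * Real.log y - 4 * (y - 1)) (Set.Ioi 0) := by
    refine monotoneOn_of_deriv_nonneg (convex_Ioi 0)
      (fun y hy => (hg y hy).continuousAt.continuousWithinAt)
      (fun y hy => ?_) (fun y hy => ?_)
    · rw [interior_Ioi] at hy
      exact (hg y hy).differentiableAt.differentiableWithinAt
    · rw [interior_Ioi] at hy
      rw [(hg y hy).deriv]
      have := Real.one_sub_inv_le_log_of_pos hy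
      linarith
  rcases le_total 1 x with h | h
  · have hm : MonotoneOn (fun y => (y + 2) * (y * Real.log y - y + 1) - 3 / 2 * (y - 1) ^ 2)
        (Set.Ici 1) := by
      refine monotoneOn_of_deriv_nonneg (convex_Ici 1)
        (fun y hy => (hh y (one_pos.trans_le hy)).continuousAt.continuousWithinAt)
        (fun y hy => ?_) (fun y hy => ?_)
      · rw [interior_Ici] at hy
        exact (hh y (one_pos.trans hy)).differentiableAt.differentiableWithinAt
      · rw [interior_Ici] at hy
        rw [(hh y (one_pos.trans hy)).deriv]
        have := gmono (Set.mem_Ioi.mpr one_pos) (Set.mem_Ioi.mpr (one_pos.trans hy)) (le_of_lt hy)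
        simpa using this
    have := hm (Set.mem_Ici.mpr le_rfl) (Set.mem_Ici.mpr h) h
    norm_num at this
    linarith
  · have hm : AntitoneOn (fun y => (y + 2) * (y * Real.log y - y + 1) - 3 / 2 * (y - 1) ^ 2)
        (Set.Ioc 0 1) := by
      refine antitoneOn_of_deriv_nonpos (convex_Ioc 0 1)
        (fun y hy => (hh y hy.1).continuousAt.continuousWithinAt)
        (fun y hy => ?_) (fun y hy => ?_)
      · rw [interior_Ioc] at hy
        exact (hh y hy.1).differentiableAt.differentiableWithinAt
      · rw [interior_Ioc] at hy
        rw [(hh y hy.1).deriv]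
        have := gmono (Set.mem_Ioi.mpr hy.1) (Set.mem_Ioi.mpr one_pos) hy.2.le
        simpa using this
    have := hm (Set.mem_Ioc.mpr ⟨hx, h⟩) (Set.mem_Ioc.mpr ⟨one_pos, le_rfl⟩) h
    norm_num at this
    linarith

/-- Homogeneous form of the previous inequality, at the ratio x/y. The denominator is the convex
combination (x + 2y)/3, so that after Cauchy–Schwarz the complementary factor averages O² over the
state ρ/3 + 2σ/3. -/
theorem entropy_term_lower_bound {x y : ℝ} (hx : 0 ≤ x) (hy : 0 < y) :
    (x - y) ^ 2 / ((x + 2 * y) / 3) / 2 ≤ x * (Real.log x - Real.log y) - x + y := by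
  rcases hx.eq_or_lt with rfl | hx
  · have : (0 - y) ^ 2 / ((0 + 2 * y) / 3) / 2 = 3 / 4 * y := by field_simp; ring
    rw [this]
    linarith
  · have h := entropy_term_lower_bound_one (div_pos hx hy)
    rw [Real.log_div hx.ne' hy.ne'] at h
    rw [div_div, div_le_iff₀ (by positivity)]
    have h2 := mul_le_mul_of_nonneg_left h (sq_nonneg y)
    have e1 : y ^ 2 * (3 / 2 * (x / y - 1) ^ 2) = 3 / 2 * (x - y) ^ 2 := by
      field_simp
    have e2 : y ^ 2 * ((x / y + 2) * (x / y * (Real.log x - Real.log y) - x / y + 1)) =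
        (x + 2 * y) * (x * (Real.log x - Real.log y) - x + y) := by
      field_simp
    rw [e1, e2] at h2
    linarith

theorem trace_mul_nonneg {n : Type*} [Fintype n] [DecidableEq n] {ρ T : Matrix n n ℂ}
    (hρ : ρ.PosSemidef) (hT : T.PosSemidef) : 0 ≤ (ρ * T).trace.re := by
  have h := diagonalizes_eigenvectorUnitary hρ.isHermitian
  have h' := diagonalizes_eigenvectorUnitary hT.isHermitian
  rw [h.trace_mul h', Complex.ofReal_re]
  exact Finset.sum_nonneg fun i _ => Finset.sum_nonneg fun j _ =>
    mul_nonneg (sq_nonneg _) (mul_nonneg (h.eigenvalue_nonneg hρ i) (h'.eigenvalue_nonneg hT j))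

theorem trace_mul_le {n : Type*} [Fintype n] [DecidableEq n] {ρ T : Matrix n n ℂ}
    (hρ : IsState ρ) {c : ℝ} (hT : (((c : ℂ) • (1 : Matrix n n ℂ)) - T).PosSemidef) :
    (ρ * T).trace.re ≤ c := by
  have := trace_mul_nonneg hρ.1 hT
  rw [Matrix.mul_sub, Matrix.mul_smul, Matrix.mul_one, trace_sub, trace_smul, hρ.2] at this
  simpa using this

/-- In the two eigenbases the trace is ∑ (x i - y j) G i j K j i, where K holds the mixed matrix
elements of O. Cauchy–Schwarz with weights t = (x i + 2 y j)/3 splits it into ∑ |G|² (x - y)²/t, at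
most twice the relative entropy, and ∑ t |K|² = Tr(ρO²)/3 + 2 Tr(σO²)/3 ≤ c. -/
theorem pinsker_observable {n : Type*} [Fintype n] [DecidableEq n] {ρ σ O : Matrix n n ℂ}
    (hρ : IsState ρ) (hσ : IsState σ) (hO : O.IsHermitian) {c : ℝ}
    (hc : (((c : ℂ) • (1 : Matrix n n ℂ)) - O * O).PosSemidef)
    (hker : ∀ v : n → ℂ, σ *ᵥ v = 0 → ρ *ᵥ v = 0) :
    ‖((ρ - σ) * O).trace‖ ^ 2 ≤
      2 * c * (ρ * cfc Real.log ρ - ρ * cfc Real.log σ).trace.re := by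
  obtain ⟨P, x, h⟩ := exists_diagonalizes hρ.1.isHermitian
  obtain ⟨Q, y, h'⟩ := exists_diagonalizes hσ.1.isHermitian
  have hl0 := h.eigenvalue_nonneg hρ.1
  have hm0 := h'.eigenvalue_nonneg hσ.1
  have hac := h.overlap_eq_zero h' hker
  have hs1 := h.sum_overlap_right h'
  have hs2 := h.sum_overlap_left h'
  have ht1 := h.sum_eigenvalues hρ
  have ht2 := h'.sum_eigenvalues hσ
  rw [h.trace_log h']
  set G := Pᴴ * Q
  set K := Qᴴ * O * P
  rw [ht1] at hs1
  rw [ht2] at hs2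
  -- the classical relative entropy dominates a weighted `χ²` sum
  have hent : (∑ i, ∑ j, ‖G i j‖ ^ 2 * ((x i - y j) ^ 2 / ((x i + 2 * y j) / 3))) / 2 ≤
      ∑ i, ∑ j, ‖G i j‖ ^ 2 * x i * (Real.log (x i) - Real.log (y j)) := by
    -- The linear terms -x + y, which make each summand nonnegative, cancel in total because both
    -- distributions have mass one.
    have e : ∑ i, ∑ j, ‖G i j‖ ^ 2 * x i * (Real.log (x i) - Real.log (y j)) =
        ∑ i, ∑ j, ‖G i j‖ ^ 2 * (x i * (Real.log (x i) - Real.log (y j)) - x i + y j) := by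
      have e2 : ∑ i, ∑ j, ‖G i j‖ ^ 2 * (x i * (Real.log (x i) - Real.log (y j)) - x i + y j) =
          ∑ i, ∑ j, ‖G i j‖ ^ 2 * x i * (Real.log (x i) - Real.log (y j)) -
          ∑ i, ∑ j, ‖G i j‖ ^ 2 * x i + ∑ i, ∑ j, ‖G i j‖ ^ 2 * y j := by
        simp only [← Finset.sum_sub_distrib, ← Finset.sum_add_distrib]
        refine Finset.sum_congr rfl fun i _ => Finset.sum_congr rfl fun j _ => ?_
        ring
      rw [e2, hs1, hs2]
      ring
    rw [e, Finset.sum_div]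
    refine Finset.sum_le_sum fun i _ => ?_
    rw [Finset.sum_div]
    refine Finset.sum_le_sum fun j _ => ?_
    rw [mul_div_assoc]
    -- The pointwise bound needs y j > 0. Where y j = 0, the kernel condition forces G i j = 0 or x
    -- i = 0, and both sides vanish.
    rcases (hm0 j).eq_or_lt with hy | hy
    · rcases mul_eq_zero.mp (hac i j hy.symm) with h0 | h0
      · simp [h0]
      · simp [h0, ← hy]
    · exact mul_le_mul_of_nonneg_left (entropy_term_lower_bound (hl0 i) hy) (sq_nonneg _)
  -- the expectation value in the two eigenbases
  have htr : ((ρ - σ) * O).trace = ∑ i, ∑ j, ((x i - y j : ℝ) : ℂ) * G i j * K j i := by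
    have e1 : ((ρ - σ) * O).trace = (((Pᴴ * ρ * Q) - (Pᴴ * σ * Q)) * K).trace := by
      rw [← Matrix.sub_mul, ← Matrix.mul_sub]
      calc ((ρ - σ) * O).trace = ((P * Pᴴ) * (ρ - σ) * (Q * Qᴴ) * O).trace := by
            rw [h.mul_conjTranspose, h'.mul_conjTranspose, Matrix.one_mul, Matrix.mul_one]
        _ = (P * (Pᴴ * (ρ - σ) * Q * Qᴴ * O)).trace := by simp only [Matrix.mul_assoc]
        _ = _ := by rw [trace_mul_comm]; simp only [K, Matrix.mul_assoc]
    have e2 : Pᴴ * ρ * Q = diagonal (fun i => (x i : ℂ)) * G := by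
      rw [h.eq]
      calc _ = (Pᴴ * P) * diagonal (fun i => (x i : ℂ)) * (Pᴴ * Q) := by
            simp only [Matrix.mul_assoc]
        _ = _ := by rw [h.conjTranspose_mul, Matrix.one_mul]
    have e3 : Pᴴ * σ * Q = G * diagonal (fun i => (y i : ℂ)) := by
      rw [h'.eq]
      calc _ = (Pᴴ * Q) * diagonal (fun i => (y i : ℂ)) * (Qᴴ * Q) := by
            simp only [Matrix.mul_assoc]
        _ = _ := by rw [h'.conjTranspose_mul, Matrix.mul_one]
    rw [e1, e2, e3, trace]
    refine Finset.sum_congr rfl fun i _ => ?_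
    rw [diag_apply, mul_apply]
    refine Finset.sum_congr rfl fun j _ => ?_
    rw [Matrix.sub_apply, diagonal_mul, mul_diagonal]
    push_cast
    ring
  have hK : ∑ i, ∑ j, ((x i + 2 * y j) / 3) * ‖K j i‖ ^ 2 ≤ c := by
    have k1 : ∑ i, ∑ j, x i * ‖K j i‖ ^ 2 ≤ c := by
      have e : (ρ * (O * O)).trace = ((∑ i, ∑ j, x i * ‖K j i‖ ^ 2 : ℝ) : ℂ) := by
        have : (ρ * (O * O)).trace = (diagonal (fun i => (x i : ℂ)) * Kᴴ * K).trace := by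
          conv_lhs => rw [h.eq]
          calc _ = (P * (diagonal (fun i => (x i : ℂ)) * Pᴴ * (O * O))).trace := by
                simp only [Matrix.mul_assoc]
            _ = (diagonal (fun i => (x i : ℂ)) * Pᴴ * O * (Q * Qᴴ) * O * P).trace := by
                rw [trace_mul_comm, h'.mul_conjTranspose, Matrix.mul_one]
                simp only [Matrix.mul_assoc]
            _ = _ := by
                simp only [K, Matrix.conjTranspose_mul, conjTranspose_conjTranspose, hO.eq,
                  Matrix.mul_assoc]
        rw [this, trace]
        push_cast
        refine Finset.sum_congr rfl fun i _ => ?_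
        rw [diag_apply, mul_apply]
        refine Finset.sum_congr rfl fun j _ => ?_
        rw [diagonal_mul, conjTranspose_apply, ← Complex.conj_mul', RCLike.star_def]
        ring
      have := trace_mul_le hρ hc
      rwa [e, Complex.ofReal_re] at this
    have k2 : ∑ i, ∑ j, y j * ‖K j i‖ ^ 2 ≤ c := by
      have e : (σ * (O * O)).trace = ((∑ j, ∑ i, y j * ‖K j i‖ ^ 2 : ℝ) : ℂ) := by
        have : (σ * (O * O)).trace = (diagonal (fun i => (y i : ℂ)) * K * Kᴴ).trace := by
          conv_lhs => rw [h'.eq]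
          calc _ = (Q * (diagonal (fun i => (y i : ℂ)) * Qᴴ * (O * O))).trace := by
                simp only [Matrix.mul_assoc]
            _ = (diagonal (fun i => (y i : ℂ)) * Qᴴ * O * (P * Pᴴ) * O * Q).trace := by
                rw [trace_mul_comm, h.mul_conjTranspose, Matrix.mul_one]
                simp only [Matrix.mul_assoc]
            _ = _ := by
                simp only [K, Matrix.conjTranspose_mul, conjTranspose_conjTranspose, hO.eq,
                  Matrix.mul_assoc]
        rw [this, trace]
        push_cast
        refine Finset.sum_congr rfl fun i _ => ?_
        rw [diag_apply, mul_apply]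
        refine Finset.sum_congr rfl fun j _ => ?_
        rw [diagonal_mul, conjTranspose_apply, ← Complex.mul_conj', RCLike.star_def]
        ring
      have := trace_mul_le hσ hc
      rwa [e, Complex.ofReal_re, Finset.sum_comm] at this
    have e : ∑ i, ∑ j, ((x i + 2 * y j) / 3) * ‖K j i‖ ^ 2 =
        (∑ i, ∑ j, x i * ‖K j i‖ ^ 2) / 3 + 2 * (∑ i, ∑ j, y j * ‖K j i‖ ^ 2) / 3 := by
      simp only [Finset.sum_div, Finset.mul_sum, ← Finset.sum_add_distrib]
      refine Finset.sum_congr rfl fun i _ => Finset.sum_congr rfl fun j _ => ?_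
      ring
    rw [e]
    linarith
  have hcs : ‖((ρ - σ) * O).trace‖ ^ 2 ≤
      (∑ i, ∑ j, ‖G i j‖ ^ 2 * ((x i - y j) ^ 2 / ((x i + 2 * y j) / 3))) *
        ∑ i, ∑ j, ((x i + 2 * y j) / 3) * ‖K j i‖ ^ 2 := by
    have hnorm : ‖((ρ - σ) * O).trace‖ ≤ ∑ i, ∑ j, |x i - y j| * ‖G i j‖ * ‖K j i‖ := by
      rw [htr]
      refine (norm_sum_le _ _).trans (Finset.sum_le_sum fun i _ => (norm_sum_le _ _).trans
        (Finset.sum_le_sum fun j _ => ?_))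
      rw [norm_mul, norm_mul, Complex.norm_real, Real.norm_eq_abs]
    refine (pow_le_pow_left₀ (norm_nonneg _) hnorm 2).trans ?_
    simp only [← Finset.sum_product']
    refine Finset.sum_sq_le_sum_mul_sum_of_sq_le_mul _ (fun p _ => ?_) (fun p _ => ?_)
      (fun p _ => ?_)
    · have := hl0 p.1; have := hm0 p.2; positivity
    · have := hl0 p.1; have := hm0 p.2; positivity
    · have ha : 0 ≤ x p.1 := hl0 p.1
      have hb : 0 ≤ y p.2 := hm0 p.2
      rw [mul_pow, mul_pow, sq_abs]
      -- A zero weight forces x = y = 0, so the convention of division by zero is harmless.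
      by_cases hz : x p.1 + 2 * y p.2 = 0
      · have h1 : x p.1 = 0 := by linarith
        have h2 : y p.2 = 0 := by linarith
        simp [h1, h2]
      · have hz' : (x p.1 + 2 * y p.2) / 3 ≠ 0 := by positivity
        refine le_of_eq ?_
        generalize (x p.1 + 2 * y p.2) / 3 = t at hz'
        field_simp
  have hGn : 0 ≤ ∑ i, ∑ j, ‖G i j‖ ^ 2 * ((x i - y j) ^ 2 / ((x i + 2 * y j) / 3)) :=
    Finset.sum_nonneg fun i _ => Finset.sum_nonneg fun j _ => by
      have := hl0 i; have := hm0 j; positivity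
  have hKn : 0 ≤ ∑ i, ∑ j, ((x i + 2 * y j) / 3) * ‖K j i‖ ^ 2 :=
    Finset.sum_nonneg fun i _ => Finset.sum_nonneg fun j _ => by
      have := hl0 i; have := hm0 j; positivity
  have hc0 : 0 ≤ c := hKn.trans hK
  calc _ ≤ _ := hcs
    _ ≤ (∑ i, ∑ j, ‖G i j‖ ^ 2 * ((x i - y j) ^ 2 / ((x i + 2 * y j) / 3))) * c :=
        mul_le_mul_of_nonneg_left hK hGn
    _ ≤ _ := by nlinarith [mul_le_mul_of_nonneg_right hent hc0]

/-! ### Tensor powers and additivity of the relative entropy -/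

theorem sum_pi_prod {n : Type*} [Fintype n] {R : Type*} [CommSemiring R] {N : ℕ}
    (f : Fin N → n → R) : ∑ x : Fin N → n, ∏ k, f k (x k) = ∏ k, ∑ i, f k i := by
  rw [Finset.prod_univ_sum, Fintype.piFinset_univ]

theorem sum_pi_prod_pair {m n : Type*} [Fintype m] [Fintype n] {R : Type*} [CommSemiring R]
    {N : ℕ} (f : Fin N → m → n → R) :
    ∑ x : Fin N → m, ∑ y : Fin N → n, ∏ k, f k (x k) (y k) = ∏ k, ∑ i, ∑ j, f k i j := by
  rw [← sum_pi_prod]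
  refine Finset.sum_congr rfl fun x _ => ?_
  exact sum_pi_prod fun k j => f k (x k) j

section TensorPow

variable {l m n : Type*} {N : ℕ}

theorem tensorPow_mul [Fintype m] (A : Matrix l m ℂ) (B : Matrix m n ℂ) :
    tensorPow N (A * B) = tensorPow N A * tensorPow N B := by
  ext x y
  simp only [tensorPow, of_apply, mul_apply, ← Finset.prod_mul_distrib]
  exact (sum_pi_prod fun k i => A (x k) i * B i (y k)).symm

theorem tensorPow_conjTranspose (A : Matrix m n ℂ) : tensorPow N Aᴴ = (tensorPow N A)ᴴ := by
  ext x y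
  simp [tensorPow, conjTranspose_apply]

theorem tensorPow_diagonal [DecidableEq n] (d : n → ℂ) :
    tensorPow N (diagonal d) = diagonal (fun x : Fin N → n => ∏ k, d (x k)) := by
  ext x y
  by_cases h : x = y
  · subst h; simp [tensorPow]
  · obtain ⟨k, hk⟩ := Function.ne_iff.mp h
    rw [diagonal_apply_ne _ h, tensorPow, of_apply]
    exact Finset.prod_eq_zero (Finset.mem_univ k) (diagonal_apply_ne _ hk)

theorem tensorPow_one [DecidableEq n] :
    tensorPow N (1 : Matrix n n ℂ) = 1 := by
  rw [← diagonal_one, tensorPow_diagonal]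
  simp

theorem tensorPow_mulVec [Fintype n] (A : Matrix m n ℂ) (v : n → ℂ) :
    tensorPow N A *ᵥ (fun x => ∏ k, v (x k)) = fun x => ∏ k, (A *ᵥ v) (x k) := by
  ext x
  simp only [tensorPow, mulVec, dotProduct, of_apply, ← Finset.prod_mul_distrib]
  exact sum_pi_prod fun k i => A (x k) i * v i

end TensorPow

section Additivity

variable {m n : Type*} [Fintype m] [DecidableEq m] [Fintype n] [DecidableEq n] {N : ℕ}

/-- Here `Diagonalizes` uses its freedom in index types: the rows are relabelled by f, while the
product eigenbasis keeps multi-indices as labels. -/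
theorem Diagonalizes.tensorPow_submatrix {l : Type*} [Fintype l] [DecidableEq l]
    {M : Matrix n n ℂ} {P : Matrix n l ℂ} {d : l → ℝ} (h : Diagonalizes M P d)
    (f : m ≃ (Fin N → n)) :
    Diagonalizes ((tensorPow N M).submatrix f f) ((tensorPow N P).submatrix f id)
      (fun x => ∏ k, d (x k)) where
  conjTranspose_mul := by
    rw [conjTranspose_submatrix, submatrix_mul_equiv, ← tensorPow_conjTranspose, ← tensorPow_mul,
      h.conjTranspose_mul, tensorPow_one, submatrix_id_id]
  mul_conjTranspose := by
    rw [conjTranspose_submatrix, ← Equiv.coe_refl, submatrix_mul_equiv, ← tensorPow_conjTranspose,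
      ← tensorPow_mul, h.mul_conjTranspose, tensorPow_one, submatrix_one_equiv]
  eq := by
    have hd : diagonal (fun x : Fin N → l => ((∏ k, d (x k) : ℝ) : ℂ)) =
        tensorPow N (diagonal fun i => (d i : ℂ)) := by
      rw [tensorPow_diagonal]; simp
    rw [hd, conjTranspose_submatrix, ← tensorPow_conjTranspose]
    conv_lhs => rw [h.eq, tensorPow_mul, tensorPow_mul]
    ext x y
    simp [mul_apply, submatrix_apply]

/-- Additivity of the classical relative entropy, for a joint weight `p` of total mass one. -/
theorem sum_pi_log_additive {l l' : Type*} [Fintype l] [Fintype l'] (p : l → l' → ℝ) (x : l → ℝ)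
    (y : l' → ℝ) (hp : ∑ i, ∑ j, p i j = 1) (hx : ∀ i j, x i = 0 → p i j = 0)
    (hy : ∀ i j, y j = 0 → p i j = 0) :
    ∑ i : Fin N → l, ∑ j : Fin N → l', (∏ k, p (i k) (j k)) *
        (Real.log (∏ k, x (i k)) - Real.log (∏ k, y (j k))) =
      N * ∑ i, ∑ j, p i j * (Real.log (x i) - Real.log (y j)) := by
  -- The logarithm of a product is a sum over sites q. Each term is written as a product over all
  -- sites with the logarithm inserted at q only, so that the sum over multi-indices factorizes. If
  -- some weight vanishes, both sides are zero; otherwise no argument of a logarithm is zero.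
  have h1 : ∀ (i : Fin N → l) (j : Fin N → l'), (∏ k, p (i k) (j k)) *
      (Real.log (∏ k, x (i k)) - Real.log (∏ k, y (j k))) =
      ∑ q : Fin N, ∏ k, p (i k) (j k) *
        (if k = q then Real.log (x (i k)) - Real.log (y (j k)) else 1) := by
    intro i j
    by_cases hz : ∀ k, p (i k) (j k) ≠ 0
    · rw [Real.log_prod (fun k _ => fun h => hz k (hx _ _ h)),
        Real.log_prod (fun k _ => fun h => hz k (hy _ _ h)), ← Finset.sum_sub_distrib,
        Finset.mul_sum]
      refine Finset.sum_congr rfl fun q _ => ?_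
      rw [Finset.prod_mul_distrib, Finset.prod_ite_eq' Finset.univ q, if_pos (Finset.mem_univ q)]
    · push Not at hz
      obtain ⟨k, hk⟩ := hz
      rw [Finset.prod_eq_zero (Finset.mem_univ k) hk, zero_mul]
      refine (Finset.sum_eq_zero fun q _ => ?_).symm
      exact Finset.prod_eq_zero (Finset.mem_univ k) (by rw [hk, zero_mul])
  have h2 : ∀ q : Fin N, ∑ i : Fin N → l, ∑ j : Fin N → l', ∏ k, p (i k) (j k) *
      (if k = q then Real.log (x (i k)) - Real.log (y (j k)) else 1) =
      ∑ i, ∑ j, p i j * (Real.log (x i) - Real.log (y j)) := by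
    intro q
    rw [sum_pi_prod_pair fun k i j => p i j *
      (if k = q then Real.log (x i) - Real.log (y j) else 1)]
    -- Every site other than q contributes the total mass of p, which is one.
    rw [Finset.prod_eq_single q]
    · simp
    · intro k _ hk
      simp [hk, hp]
    · simp
  simp only [h1]
  simp only [Finset.sum_comm (s := (Finset.univ : Finset (Fin N → l')))
    (t := Finset.univ (α := Fin N))]
  rw [Finset.sum_comm]
  simp only [h2]
  simp

/-- A lower bound on the relative entropy of a pair of states is multiplied by `N` on the `N`-fold
tensor powers. -/
theorem le_relEntropy_tensorPow (hN : 1 ≤ N) {ρ σ : Matrix n n ℂ} (hρ : IsState ρ)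
    (hσ : IsState σ) (f : m ≃ (Fin N → n)) {r : ℝ}
    (hr : (∀ v : n → ℂ, σ *ᵥ v = 0 → ρ *ᵥ v = 0) →
      r ≤ (ρ * cfc Real.log ρ - ρ * cfc Real.log σ).trace.re) :
    ((N * r : ℝ) : EReal) ≤ relEntropy ((tensorPow N ρ).submatrix f f)
      ((tensorPow N σ).submatrix f f) := by
  rw [relEntropy]
  split_ifs with hker
  swap
  · exact le_top
  -- The kernel condition descends to one copy: for v in ker σ, apply it to v^{⊗N}. This gives
  -- (ρv)^{⊗N} = 0, whose entries at constant multi-indices are the N-th powers of the entries of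
  -- ρv. Both directions need N ≥ 1.
  have hker1 : ∀ v : n → ℂ, σ *ᵥ v = 0 → ρ *ᵥ v = 0 := by
    intro v hv
    have key : ∀ M : Matrix n n ℂ,
        (tensorPow N M).submatrix f f *ᵥ (fun x => ∏ k, v (f x k)) =
          fun x => ∏ k, (M *ᵥ v) (f x k) := by
      intro M
      have := submatrix_mulVec_equiv (tensorPow N M) (fun x => ∏ k, v (f x k)) f f
      rw [this]
      have e : ((fun x => ∏ k, v (f x k)) ∘ f.symm) = fun x => ∏ k, v (x k) := by
        ext x; simp
      rw [e, tensorPow_mulVec]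
      rfl
    have h1 := hker (fun x => ∏ k, v (f x k)) (by
      rw [key, hv]
      ext x
      exact Finset.prod_eq_zero (Finset.mem_univ ⟨0, hN⟩) rfl)
    rw [key] at h1
    ext i
    have h2 := congrFun h1 (f.symm fun _ => i)
    simp only [Equiv.apply_symm_apply, Finset.prod_const, Pi.zero_apply] at h2
    exact pow_eq_zero_iff (by simp; omega) |>.mp h2
  obtain ⟨P, x, h⟩ := exists_diagonalizes hρ.1.isHermitian
  obtain ⟨Q, y, h'⟩ := exists_diagonalizes hσ.1.isHermitian
  have hac := h.overlap_eq_zero h' hker1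
  have hs1 := (h.sum_overlap_right h').trans (h.sum_eigenvalues hρ)
  have hr' := hr hker1
  rw [h.trace_log h'] at hr'
  rw [(h.tensorPow_submatrix f).trace_log (h'.tensorPow_submatrix f), EReal.coe_le_coe_iff]
  have hG : ((tensorPow N P).submatrix f id)ᴴ * (tensorPow N Q).submatrix f id =
      tensorPow N (Pᴴ * Q) := by
    rw [conjTranspose_submatrix, submatrix_mul_equiv, ← tensorPow_conjTranspose, ← tensorPow_mul,
      submatrix_id_id]
  have hadd := sum_pi_log_additive (N := N) (fun i j => ‖(Pᴴ * Q) i j‖ ^ 2 * x i) x y hs1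
    (fun i j hi => by simp [hi]) hac
  have hterm : ∀ i j : Fin N → n, ‖tensorPow N (Pᴴ * Q) i j‖ ^ 2 * ∏ k, x (i k) =
      ∏ k, ‖(Pᴴ * Q) (i k) (j k)‖ ^ 2 * x (i k) := by
    intro i j
    rw [tensorPow, of_apply, norm_prod, ← Finset.prod_pow, Finset.prod_mul_distrib]
  rw [hG]
  simp only [hterm]
  rw [hadd]
  exact mul_le_mul_of_nonneg_left hr' (Nat.cast_nonneg N)

/-- The Pinsker bound for an observable, on tensor powers. -/
theorem pinsker_observable_tensorPow (hN : 1 ≤ N) {ρ σ O : Matrix n n ℂ} (hρ : IsState ρ)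
    (hσ : IsState σ) (f : m ≃ (Fin N → n)) (hO : O.IsHermitian) {c : ℝ} (hc0 : 0 < c)
    (hc : (((c : ℂ) • (1 : Matrix n n ℂ)) - O * O).PosSemidef) :
    ((N * (‖((ρ - σ) * O).trace‖ ^ 2 / (2 * c)) : ℝ) : EReal) ≤
      relEntropy ((tensorPow N ρ).submatrix f f) ((tensorPow N σ).submatrix f f) := by
  refine le_relEntropy_tensorPow hN hρ hσ f fun hker => ?_
  rw [div_le_iff₀ (by positivity), mul_comm]
  exact pinsker_observable hρ hσ hO hc hker

end Additivity

/-! ### Partial traces -/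

section PartialTrace

variable {m n : Type*} [Fintype m] [DecidableEq m] [Fintype n] [DecidableEq n]

theorem trace_traceRight (M : Matrix (m × n) (m × n) ℂ) : (traceRight M).trace = M.trace := by
  simp [trace, traceRight, Fintype.sum_prod_type]

theorem trace_traceLeft (M : Matrix (m × n) (m × n) ℂ) : (traceLeft M).trace = M.trace := by
  simp only [trace, traceLeft, Fintype.sum_prod_type, diag_apply, of_apply]
  exact Finset.sum_comm

theorem trace_traceRight_mul (M : Matrix (m × n) (m × n) ℂ) (O : Matrix m m ℂ) :
    (traceRight M * O).trace = (M * (O ⊗ₖ (1 : Matrix n n ℂ))).trace := by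
  simp only [trace, traceRight, Fintype.sum_prod_type, diag_apply, of_apply, mul_apply,
    kronecker_apply, one_apply, Finset.sum_mul, mul_ite, mul_one, mul_zero, Finset.sum_ite_eq',
    Finset.mem_univ, if_true]
  exact Finset.sum_congr rfl fun i _ => Finset.sum_comm

theorem trace_traceLeft_mul (M : Matrix (m × n) (m × n) ℂ) (O : Matrix n n ℂ) :
    (traceLeft M * O).trace = (M * ((1 : Matrix m m ℂ) ⊗ₖ O)).trace := by
  have h : ∀ (z : m) (i : n), (M * ((1 : Matrix m m ℂ) ⊗ₖ O)) (z, i) (z, i) =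
      ∑ j, M (z, i) (z, j) * O j i := by
    intro z i
    rw [mul_apply, Fintype.sum_prod_type, Finset.sum_eq_single z]
    · simp
    · intro y _ hy
      simp [one_apply_ne hy]
    · simp
  simp only [trace, Fintype.sum_prod_type, diag_apply, h, mul_apply, traceLeft, of_apply,
    Finset.sum_mul]
  rw [Finset.sum_comm]
  simp only [Finset.sum_comm (s := (Finset.univ : Finset n)) (t := (Finset.univ : Finset m))]
  exact Finset.sum_congr rfl fun z _ => Finset.sum_comm

theorem posSemidef_traceRight {M : Matrix (m × n) (m × n) ℂ} (hM : M.PosSemidef) :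
    (traceRight M).PosSemidef := by
  have : traceRight M = ∑ z, M.submatrix (fun x => (x, z)) (fun x => (x, z)) := by
    ext x y
    simp [traceRight, Matrix.sum_apply]
  rw [this]
  exact posSemidef_sum _ fun z _ => hM.submatrix _

theorem posSemidef_traceLeft {M : Matrix (m × n) (m × n) ℂ} (hM : M.PosSemidef) :
    (traceLeft M).PosSemidef := by
  have : traceLeft M = ∑ z, M.submatrix (fun x => (z, x)) (fun x => (z, x)) := by
    ext x y
    simp [traceLeft, Matrix.sum_apply]
  rw [this]
  exact posSemidef_sum _ fun z _ => hM.submatrix _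

theorem IsState.traceRight {M : Matrix (m × n) (m × n) ℂ} (hM : IsState M) :
    IsState (traceRight M) :=
  ⟨posSemidef_traceRight hM.1, (trace_traceRight M).trans hM.2⟩

theorem IsState.traceLeft {M : Matrix (m × n) (m × n) ℂ} (hM : IsState M) :
    IsState (traceLeft M) :=
  ⟨posSemidef_traceLeft hM.1, (trace_traceLeft M).trans hM.2⟩

theorem IsState.kronecker {ρ : Matrix m m ℂ} {σ : Matrix n n ℂ} (hρ : IsState ρ)
    (hσ : IsState σ) : IsState (ρ ⊗ₖ σ) :=
  ⟨hρ.1.kronecker hσ.1, by rw [trace_kronecker, hρ.2, hσ.2, one_mul]⟩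

end PartialTrace

/-! ### Regrouping of tensor factors -/

/-- Regrouping `A^N ⊗ W ≃ (A ⊗ W₁)^N` for `W = W₁^N`. -/
def pairEquiv {N : ℕ} {s w : Type*} (a : Type*) (e : w ≃ (Fin N → s)) :
    (Fin N → a) × w ≃ (Fin N → a × s) :=
  ((Equiv.refl _).prodCongr e).trans (Equiv.arrowProdEquivProdArrow _ _ _).symm

section Regroup

variable {b s w : Type*} [Fintype b] [DecidableEq b] [Fintype s] [DecidableEq s] [Fintype w]
  [DecidableEq w] {N : ℕ} (e : w ≃ (Fin N → s))

@[simp] theorem pairEquiv_apply {a : Type*} (p : (Fin N → a) × w) :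
    pairEquiv a e p = fun k => (p.1 k, e p.2 k) := rfl

theorem traceLeft_tensorPow (τ : Matrix (b × s) (b × s) ℂ) :
    traceLeft ((tensorPow N τ).submatrix (pairEquiv b e) (pairEquiv b e)) =
      (tensorPow N (traceLeft τ)).submatrix e e := by
  ext i j
  simp only [traceLeft, tensorPow, of_apply, submatrix_apply, pairEquiv_apply]
  exact sum_pi_prod fun k z => τ (z, e i k) (z, e j k)

theorem traceRight_tensorPow (τ : Matrix (b × s) (b × s) ℂ) :
    traceRight ((tensorPow N τ).submatrix (pairEquiv b e) (pairEquiv b e)) =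
      tensorPow N (traceRight τ) := by
  ext x y
  simp only [traceRight, tensorPow, of_apply, submatrix_apply, pairEquiv_apply]
  rw [e.sum_comp (fun z => ∏ k, τ (x k, z k) (y k, z k))]
  exact sum_pi_prod fun k z => τ (x k, z) (y k, z)

theorem tensorPow_kronecker (σ : Matrix b b ℂ) (ω : Matrix s s ℂ) :
    tensorPow N σ ⊗ₖ (tensorPow N ω).submatrix e e =
      (tensorPow N (σ ⊗ₖ ω)).submatrix (pairEquiv b e) (pairEquiv b e) := by
  ext x y
  simp [tensorPow, Finset.prod_mul_distrib]

end Regroup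

/-! ### The connected state for a product coupling -/

section Coupling

variable {a a' b b' s w : Type*} [Fintype a] [DecidableEq a] [Fintype a'] [DecidableEq a']
  [Fintype b] [DecidableEq b] [Fintype b'] [DecidableEq b'] [Fintype s] [DecidableEq s]
  [Fintype w] [DecidableEq w]

/-- The isometry `∑ᵢ U Xᵢ ⊗ |i⟩` from `A Ā` to `B B̄ W`. -/
def branch (U : Matrix (b × b') (a × a') ℂ) (X : s → Matrix a a ℂ) :
    Matrix ((b × b') × s) (a × a') ℂ :=
  Matrix.of fun p q => (U * opA a' (X p.2)) p.1 q

/-- The state `∑ᵢⱼ tr_{B̄} (U Xᵢ ρ Xⱼ† U†) ⊗ |i⟩⟨j|` of `B W`. -/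
def branchState (ρ : Matrix (a × a') (a × a') ℂ) (U : Matrix (b × b') (a × a') ℂ)
    (X : s → Matrix a a ℂ) : Matrix (b × s) (b × s) ℂ :=
  traceRight ((branch U X * ρ * (branch U X)ᴴ).submatrix
    (fun p : (b × s) × b' => ((p.1.1, p.2), p.1.2)) (fun p => ((p.1.1, p.2), p.1.2)))

/-- Factoring through the embedding φ ↦ φ ⊗ ψ shows that a coupling enters the final state only
through its action on vectors φ ⊗ ψ. -/
theorem kronecker_vecMulVec {n : Type*} [Fintype n] [DecidableEq n] (M : Matrix n n ℂ)
    (ψ : w → ℂ) :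
    M ⊗ₖ vecMulVec ψ (star ψ) =
      (Matrix.of fun (p : n × w) q => if p.1 = q then ψ p.2 else 0) * M *
        (Matrix.of fun (p : n × w) q => if p.1 = q then ψ p.2 else 0)ᴴ := by
  ext ⟨x, i⟩ ⟨y, j⟩
  simp [mul_apply, vecMulVec_apply, conjTranspose_apply, apply_ite star]
  ring

/-- For a product coupling and a product initial vector of W, the whole evolution is the tensor
power of the one-copy map `branch`, built from the s₀ column of blocks of V. -/
theorem evolved_column {N : ℕ} (U : Matrix (b × b') (a × a') ℂ)
    (V : Matrix (a × s) (a × s) ℂ) (e : w ≃ (Fin N → s)) (s₀ : s) :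
    (tensorPow N U ⊗ₖ (1 : Matrix w w ℂ)) *
      (extendCoupling N a' ((tensorPow N V).submatrix (pairEquiv a e) (pairEquiv a e)) *
        (Matrix.of fun (p : (Fin N → a × a') × w) q =>
          if p.1 = q then (Pi.single (e.symm fun _ => s₀) 1 : w → ℂ) p.2 else 0)) =
      (tensorPow N (branch U fun i => V.submatrix (fun x => (x, i)) (fun x => (x, s₀)))).submatrix
        (pairEquiv (b × b') e) id := by
  have h1 : extendCoupling N a' ((tensorPow N V).submatrix (pairEquiv a e) (pairEquiv a e)) *
        (Matrix.of fun (p : (Fin N → a × a') × w) q =>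
          if p.1 = q then (Pi.single (e.symm fun _ => s₀) 1 : w → ℂ) p.2 else 0) =
      Matrix.of fun (p : (Fin N → a × a') × w) q => ∏ k,
        opA a' (V.submatrix (fun x => (x, e p.2 k)) (fun x => (x, s₀))) (p.1 k) (q k) := by
    ext ⟨z, i⟩ q
    simp only [mul_apply, of_apply, Fintype.sum_prod_type, Pi.single_apply, mul_ite, mul_one,
      mul_zero, Finset.sum_ite_irrel, Finset.sum_const_zero, Finset.sum_ite_eq', Finset.mem_univ,
      if_true, extendCoupling, submatrix_apply, kronecker_apply, tensorPow, pairEquiv_apply,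
      Equiv.apply_symm_apply, opA]
    -- The identity on Ā^N is itself a tensor power, so it merges with the coupling copy by copy.
    rw [← tensorPow_one, tensorPow, of_apply, ← Finset.prod_mul_distrib]
    rfl
  rw [h1]
  ext ⟨z, i⟩ q
  rw [mul_apply, Fintype.sum_prod_type]
  simp only [of_apply, kronecker_apply, submatrix_apply, one_apply, mul_ite, ite_mul, mul_one,
    zero_mul, mul_zero, Finset.sum_ite_eq, Finset.mem_univ, if_true, tensorPow, pairEquiv_apply,
    branch, ← Finset.prod_mul_distrib, id]
  exact sum_pi_prod fun k y => U (z k) y *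
    opA a' (V.submatrix (fun x => (x, e i k)) (fun x => (x, s₀))) y (q k)

theorem stateBW_tensorPow {N : ℕ} (ρ : Matrix (a × a') (a × a') ℂ)
    (U : Matrix (b × b') (a × a') ℂ) (V : Matrix (a × s) (a × s) ℂ) (e : w ≃ (Fin N → s))
    (s₀ : s) :
    stateBW N ρ U ((tensorPow N V).submatrix (pairEquiv a e) (pairEquiv a e))
        (Pi.single (e.symm fun _ => s₀) 1) =
      (tensorPow N (branchState ρ U
        fun i => V.submatrix (fun x => (x, i)) (fun x => (x, s₀)))).submatrix
        (pairEquiv b e) (pairEquiv b e) := by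
  have h := evolved_column (a' := a') U V e s₀
  rw [stateBW, coupledState, kronecker_vecMulVec]
  set E := extendCoupling N a' ((tensorPow N V).submatrix (pairEquiv a e) (pairEquiv a e))
  set Ψ : Matrix ((Fin N → a × a') × w) (Fin N → a × a') ℂ := Matrix.of fun p q =>
    if p.1 = q then (Pi.single (e.symm fun _ => s₀) 1 : w → ℂ) p.2 else 0
  set T := tensorPow N U ⊗ₖ (1 : Matrix w w ℂ)
  set X : s → Matrix a a ℂ := fun i => V.submatrix (fun x => (x, i)) (fun x => (x, s₀))
  have h1 : T * (E * (Ψ * tensorPow N ρ * Ψᴴ) * Eᴴ) * Tᴴ =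
      (T * (E * Ψ)) * tensorPow N ρ * (T * (E * Ψ))ᴴ := by
    simp only [conjTranspose_mul, Matrix.mul_assoc]
  have h2 : (T * (E * Ψ)) * tensorPow N ρ * (T * (E * Ψ))ᴴ =
      (tensorPow N (branch U X * ρ * (branch U X)ᴴ)).submatrix
        (pairEquiv (b × b') e) (pairEquiv (b × b') e) := by
    rw [h, tensorPow_mul, tensorPow_mul, tensorPow_conjTranspose]
    ext x y
    simp [mul_apply, submatrix_apply]
  rw [h1, h2]
  ext ⟨x, i⟩ ⟨y, j⟩
  simp only [traceRight, branchState, tensorPow, of_apply, submatrix_apply, pairEquiv_apply]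
  exact sum_pi_prod fun k z =>
    (branch U X * ρ * (branch U X)ᴴ) ((x k, z), e i k) ((y k, z), e j k)

theorem branchState_apply (ρ : Matrix (a × a') (a × a') ℂ) (U : Matrix (b × b') (a × a') ℂ)
    (X : s → Matrix a a ℂ) (p q : b × s) :
    branchState ρ U X p q =
      traceRight ((U * opA a' (X p.2)) * ρ * (U * opA a' (X q.2))ᴴ) p.1 q.1 := rfl

/-- Expectation values in the state of `B W` as correlation functions in `ρ`. -/
theorem trace_branchState_mul (ρ : Matrix (a × a') (a × a') ℂ)
    (U : Matrix (b × b') (a × a') ℂ) (X : s → Matrix a a ℂ) (O : Matrix b b ℂ)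
    (Y : Matrix s s ℂ) :
    (branchState ρ U X * (O ⊗ₖ Y)).trace =
      ∑ i, ∑ j, Y j i * (ρ * ((opA a' (X j))ᴴ * heisenbergB U O * opA a' (X i))).trace := by
  have h1 : ∀ i j, (ρ * ((opA a' (X j))ᴴ * heisenbergB U O * opA a' (X i))).trace =
      (traceRight ((U * opA a' (X i)) * ρ * (U * opA a' (X j))ᴴ) * O).trace := by
    intro i j
    rw [trace_traceRight_mul, Matrix.mul_assoc _ ρ, Matrix.mul_assoc _ (ρ * _),
      trace_mul_comm (U * opA a' (X i))]
    simp only [heisenbergB, conjTranspose_mul, Matrix.mul_assoc]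
  simp only [h1]
  simp only [trace, diag_apply, mul_apply (M := branchState ρ U X),
    mul_apply (M := traceRight _), Fintype.sum_prod_type, kronecker_apply,
    branchState_apply, Finset.mul_sum]
  rw [Finset.sum_comm]
  refine Finset.sum_congr rfl fun i _ => ?_
  rw [Finset.sum_comm (s := (Finset.univ : Finset s))]
  refine Finset.sum_congr rfl fun x _ => ?_
  rw [Finset.sum_comm]
  refine Finset.sum_congr rfl fun j _ => Finset.sum_congr rfl fun y _ => ?_
  ring

theorem isState_branchState {ρ : Matrix (a × a') (a × a') ℂ} (hρ : IsState ρ)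
    {U : Matrix (b × b') (a × a') ℂ} (hU : Uᴴ * U = 1) {X : s → Matrix a a ℂ}
    (hX : ∑ i, (X i)ᴴ * X i = 1) : IsState (branchState ρ U X) := by
  refine ⟨posSemidef_traceRight ((hρ.1.mul_mul_conjTranspose_same _).submatrix _), ?_⟩
  -- The trace is the expectation of 1 ⊗ 1, where the branches combine into ∑ Xᵢ† Xᵢ = 1.
  have h := trace_branchState_mul ρ U X 1 1
  have hH : heisenbergB U (1 : Matrix b b ℂ) = 1 := by simp [heisenbergB, hU]
  have hop : ∑ i, (opA a' (X i))ᴴ * opA a' (X i) = 1 := by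
    have : ∀ i, (opA a' (X i))ᴴ * opA a' (X i) = ((X i)ᴴ * X i) ⊗ₖ (1 : Matrix a' a' ℂ) := by
      intro i
      rw [opA, conjTranspose_kronecker, conjTranspose_one, ← mul_kronecker_mul, Matrix.one_mul]
    simp only [this]
    rw [← one_kronecker_one, ← hX]
    ext p q
    simp [Matrix.sum_apply, Finset.sum_mul]
  simp only [one_kronecker_one, Matrix.mul_one, hH, one_apply, ite_mul, one_mul, zero_mul,
    Finset.sum_ite_eq', Finset.mem_univ, if_true] at h
  rw [h, ← trace_sum, ← Finset.mul_sum, hop, Matrix.mul_one, hρ.2]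

theorem isState_stateB0 {ρ : Matrix (a × a') (a × a') ℂ} (hρ : IsState ρ)
    {U : Matrix (b × b') (a × a') ℂ} (hU : Uᴴ * U = 1) : IsState (stateB0 ρ U) := by
  refine IsState.traceRight ⟨hρ.1.mul_mul_conjTranspose_same U, ?_⟩
  rw [trace_mul_comm, ← Matrix.mul_assoc, hU, Matrix.one_mul, hρ.2]

theorem trace_stateB0_mul (ρ : Matrix (a × a') (a × a') ℂ) (U : Matrix (b × b') (a × a') ℂ)
    (O : Matrix b b ℂ) : (stateB0 ρ U * O).trace = (ρ * heisenbergB U O).trace := by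
  rw [stateB0, trace_traceRight_mul, heisenbergB, Matrix.mul_assoc, Matrix.mul_assoc,
    trace_mul_comm]
  simp only [Matrix.mul_assoc]

end Coupling

/-! ### The control coupling -/

section OpNorm

variable {n : Type*} [Fintype n] [DecidableEq n]

theorem opNorm_pos {O : Matrix n n ℂ} (h : O ≠ 0) : 0 < opNorm O := by
  rw [opNorm, norm_pos_iff]
  exact fun h0 => h ((Matrix.toEuclideanCLM (n := n) (𝕜 := ℂ)).injective
    (h0.trans (map_zero _).symm))

theorem star_dotProduct_self (v : n → ℂ) :
    star v ⬝ᵥ v = ((‖WithLp.toLp 2 v‖ ^ 2 : ℝ) : ℂ) := by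
  rw [EuclideanSpace.norm_sq_eq]
  simp [dotProduct, Complex.conj_mul']

theorem posSemidef_opNorm_sq_sub {O : Matrix n n ℂ} (hO : O.IsHermitian) :
    (((opNorm O ^ 2 : ℝ) : ℂ) • (1 : Matrix n n ℂ) - O * O).PosSemidef := by
  refine PosSemidef.of_dotProduct_mulVec_nonneg ?_ fun v => ?_
  · rw [IsHermitian, conjTranspose_sub, conjTranspose_smul, conjTranspose_one, conjTranspose_mul,
      hO.eq, RCLike.star_def, Complex.conj_ofReal]
  · have h1 : star v ⬝ᵥ (O * O) *ᵥ v = star (O *ᵥ v) ⬝ᵥ (O *ᵥ v) := by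
      rw [star_mulVec, hO.eq, ← dotProduct_mulVec, mulVec_mulVec]
    have h2 : ‖WithLp.toLp 2 (O *ᵥ v)‖ ≤ opNorm O * ‖WithLp.toLp 2 v‖ :=
      (Matrix.toEuclideanCLM (n := n) (𝕜 := ℂ) O).le_opNorm (WithLp.toLp 2 v)
    rw [sub_mulVec, dotProduct_sub, h1, smul_mulVec, one_mulVec, dotProduct_smul,
      star_dotProduct_self, star_dotProduct_self, smul_eq_mul, ← Complex.ofReal_mul,
      ← Complex.ofReal_sub, Complex.zero_le_real, ← mul_pow, sub_nonneg]
    exact pow_le_pow_left₀ (norm_nonneg _) h2 2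

end OpNorm

section Control

variable {a : Type*} [Fintype a] [DecidableEq a]

/-- `√(1 - O²/‖O‖²)`. -/
noncomputable def coOp (O : Matrix a a ℂ) : Matrix a a ℂ :=
  cfc Real.sqrt (1 - ((opNorm O) ^ 2)⁻¹ • (O * O))

theorem coOp_properties {O : Matrix a a ℂ} (hO : O.IsHermitian) (hO0 : O ≠ 0) :
    (coOp O)ᴴ = coOp O ∧ Commute ((opNorm O)⁻¹ • O) (coOp O) ∧
      ((opNorm O)⁻¹ • O) * ((opNorm O)⁻¹ • O) + coOp O * coOp O = 1 := by
  have hc := opNorm_pos hO0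
  obtain ⟨P, d, h⟩ := exists_diagonalizes hO
  have hS : Diagonalizes (coOp O) P _ :=
    (h.one.sub ((h.mul_eq h).smul ((opNorm O) ^ 2)⁻¹)).cfc Real.sqrt
  -- Since `Real.sqrt` truncates at zero, the square root squares back only because every eigenvalue
  -- is bounded by the operator norm.
  have hd : ∀ i, 0 ≤ 1 - ((opNorm O) ^ 2)⁻¹ * (d i * d i) := by
    intro i
    have hpos := posSemidef_opNorm_sq_sub hO
    have e : ((opNorm O ^ 2 : ℝ) : ℂ) • (1 : Matrix a a ℂ) =
        (opNorm O ^ 2) • (1 : Matrix a a ℂ) := by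
      ext i j; simp
    rw [e] at hpos
    have := ((h.one.smul (opNorm O ^ 2)).sub (h.mul_eq h)).eigenvalue_nonneg hpos i
    rw [sub_nonneg, inv_mul_le_iff₀ (by positivity)]
    linarith
  have hC := h.smul (opNorm O)⁻¹
  refine ⟨hS.isHermitian, ?_, ?_⟩
  · rw [commute_iff_eq, (hC.mul_eq hS).eq, (hS.mul_eq hC).eq]
    simp only [mul_comm]
  · rw [← eq_sub_iff_add_eq', h.one.sub (hC.mul_eq hC) |>.eq, (hS.mul_eq hS).eq]
    congr 3
    ext i
    rw [Real.mul_self_sqrt (hd i)]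
    congr 2
    ring

/-- Blocks of the unitary extending the control isometry. -/
noncomputable def controlBlock (O : Matrix a a ℂ) : Fin 3 → Fin 3 → Matrix a a ℂ :=
  ![![Real.sqrt (1 / 2) • 1, 0, Real.sqrt (1 / 2) • 1],
    ![Real.sqrt (1 / 2) • ((opNorm O)⁻¹ • O), -coOp O, -(Real.sqrt (1 / 2) • ((opNorm O)⁻¹ • O))],
    ![Real.sqrt (1 / 2) • coOp O, (opNorm O)⁻¹ • O, -(Real.sqrt (1 / 2) • coOp O)]]

/-- The unitary on `A ⊗ ℂ³` with blocks `controlBlock`. -/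
noncomputable def controlUnitary (O : Matrix a a ℂ) : Matrix (a × Fin 3) (a × Fin 3) ℂ :=
  Matrix.of fun p q => controlBlock O p.2 q.2 p.1 q.1

theorem controlBlock_zero (O : Matrix a a ℂ) (i : Fin 3) :
    controlBlock O i 0 = controlOp O i := by
  fin_cases i <;> rfl

/-- With C = O/‖O‖ and S = √(1 - C²), the block columns are √½(1, C, S), (0, -S, C) and √½(1, -C,
-S). Their orthonormality uses only that C and S are Hermitian, commute and satisfy C² + S² = 1, as
for a cosine and a sine. -/
theorem controlBlock_orthogonal {O : Matrix a a ℂ} (hO : O.IsHermitian) (hO0 : O ≠ 0)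
    (i j : Fin 3) :
    ∑ k, (controlBlock O k i)ᴴ * controlBlock O k j = if i = j then 1 else 0 := by
  obtain ⟨hS, hcomm, hsum⟩ := coOp_properties hO hO0
  have hC : ((opNorm O)⁻¹ • O)ᴴ = (opNorm O)⁻¹ • O := by simp [conjTranspose_smul, hO.eq]
  unfold controlBlock
  generalize (opNorm O)⁻¹ • O = C at *
  generalize coOp O = S at *
  have hr : Real.sqrt (1 / 2) * Real.sqrt (1 / 2) = 1 / 2 := Real.mul_self_sqrt (by norm_num)
  generalize Real.sqrt (1 / 2) = r at *
  have hcomm' : C * S = S * C := hcomm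
  have hsum' : C * C = 1 - S * S := eq_sub_of_add_eq hsum
  fin_cases i <;> fin_cases j <;>
    simp [Fin.sum_univ_three, conjTranspose_smul, hC, hS, smul_smul, hr, hcomm', hsum',
      smul_sub] <;>
    module

theorem controlUnitary_mem {O : Matrix a a ℂ} (hO : O.IsHermitian) (hO0 : O ≠ 0) :
    controlUnitary O ∈ Matrix.unitaryGroup (a × Fin 3) ℂ := by
  rw [mem_unitaryGroup_iff', star_eq_conjTranspose]
  ext ⟨x, i⟩ ⟨y, j⟩
  have h := congrFun (congrFun (controlBlock_orthogonal hO hO0 i j) x) y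
  have h1 : ((controlUnitary O)ᴴ * controlUnitary O) (x, i) (y, j) =
      (∑ k, (controlBlock O k i)ᴴ * controlBlock O k j) x y := by
    rw [mul_apply, Fintype.sum_prod_type, Finset.sum_comm, Matrix.sum_apply]
    rfl
  rw [h1, h]
  by_cases hij : i = j <;> simp [hij, one_apply]

theorem tensorPow_submatrix_mem_unitaryGroup {n m : Type*} [Fintype n] [DecidableEq n]
    [Fintype m] [DecidableEq m] {N : ℕ} {V : Matrix n n ℂ} (hV : V ∈ Matrix.unitaryGroup n ℂ)
    (f : m ≃ (Fin N → n)) :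
    (tensorPow N V).submatrix f f ∈ Matrix.unitaryGroup m ℂ := by
  rw [mem_unitaryGroup_iff', star_eq_conjTranspose] at hV ⊢
  rw [conjTranspose_submatrix, submatrix_mul_equiv, ← tensorPow_conjTranspose, ← tensorPow_mul, hV,
    tensorPow_one, submatrix_one_equiv]

end Control

/-! ### Correlation functions as expectation values -/

/-- The off-diagonal Hermitian observable `u |0⟩⟨1| + ū |1⟩⟨0|` of the ancilla. -/
def offDiag (u : ℂ) : Matrix (Fin 3) (Fin 3) ℂ := !![0, u, 0; star u, 0, 0; 0, 0, 0]

theorem offDiag_isHermitian (u : ℂ) : (offDiag u).IsHermitian := by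
  ext i j
  fin_cases i <;> fin_cases j <;> simp [offDiag]

theorem offDiag_mul_self {u : ℂ} (hu : u * star u = 1) :
    offDiag u * offDiag u = diagonal ![1, 1, 0] := by
  have hu' : star u * u = 1 := by rw [mul_comm, hu]
  rw [RCLike.star_def] at hu hu'
  ext i j
  fin_cases i <;> fin_cases j <;> simp [offDiag, mul_apply, Fin.sum_univ_three, hu, hu']

/-- For a phase u the ancilla observable squares to the projection Π onto |0⟩, |1⟩. The difference
splits as (‖O‖² - O²) ⊗ Π + ‖O‖² ⊗ (1 - Π), a sum of positive terms. -/
theorem posSemidef_kronecker_offDiag {b : Type*} [Fintype b] [DecidableEq b] {O : Matrix b b ℂ}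
    (hO : O.IsHermitian) {u : ℂ} (hu : u * star u = 1) :
    (((opNorm O ^ 2 : ℝ) : ℂ) • (1 : Matrix (b × Fin 3) (b × Fin 3) ℂ) -
      (O ⊗ₖ offDiag u) * (O ⊗ₖ offDiag u)).PosSemidef := by
  have e : ((opNorm O ^ 2 : ℝ) : ℂ) • (1 : Matrix (b × Fin 3) (b × Fin 3) ℂ) -
      (O ⊗ₖ offDiag u) * (O ⊗ₖ offDiag u) =
      (((opNorm O ^ 2 : ℝ) : ℂ) • (1 : Matrix b b ℂ) - O * O) ⊗ₖ diagonal ![1, 1, 0] +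
      (((opNorm O ^ 2 : ℝ) : ℂ) • (1 : Matrix b b ℂ)) ⊗ₖ diagonal ![0, 0, 1] := by
    have h1 : (1 : Matrix (Fin 3) (Fin 3) ℂ) = diagonal ![1, 1, 0] + diagonal ![0, 0, 1] := by
      ext i j
      fin_cases i <;> fin_cases j <;> simp
    rw [← mul_kronecker_mul, offDiag_mul_self hu, ← one_kronecker_one (m := b) (n := Fin 3)]
    conv_lhs => rw [h1]
    ext ⟨x, i⟩ ⟨y, j⟩
    simp only [Matrix.sub_apply, Matrix.add_apply, Matrix.smul_apply, kronecker_apply, smul_eq_mul]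
    ring
  rw [e]
  refine PosSemidef.add (PosSemidef.kronecker (posSemidef_opNorm_sq_sub hO) ?_)
    (PosSemidef.kronecker ?_ ?_)
  · refine PosSemidef.diagonal fun i => ?_
    fin_cases i <;> simp
  · refine PosSemidef.one.smul ?_
    rw [Complex.zero_le_real]
    positivity
  · refine PosSemidef.diagonal fun i => ?_
    fin_cases i <;> simp

section Correlators

variable {a a' b b' : Type*} [Fintype a] [DecidableEq a] [Fintype a'] [DecidableEq a']
  [Fintype b] [DecidableEq b] [Fintype b'] [DecidableEq b']

theorem opA_smul (c : ℝ) (O : Matrix a a ℂ) : opA a' (c • O) = c • opA a' O := by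
  rw [opA, opA, smul_kronecker]

/-- Only the cross terms of X₀ and X₁ survive, and their two factors √½ give the 1/2. X₂ serves only
to complete the isometry. -/
theorem trace_branchState_offDiag {ρ : Matrix (a × a') (a × a') ℂ}
    {U : Matrix (b × b') (a × a') ℂ} {OA : Matrix a a ℂ} (hOA : OA.IsHermitian)
    (O : Matrix b b ℂ) (u : ℂ) :
    (branchState ρ U (controlOp OA) * (O ⊗ₖ offDiag u)).trace =
      ((1 / 2 * (opNorm OA)⁻¹ : ℝ) : ℂ) *
        (u * (ρ * (heisenbergB U O * opA a' OA)).trace +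
          star u * (ρ * (opA a' OA * heisenbergB U O)).trace) := by
  have hr : ((Real.sqrt 2 : ℝ) : ℂ)⁻¹ * ((Real.sqrt 2 : ℝ) : ℂ)⁻¹ = 2⁻¹ := by
    rw [← mul_inv, ← Complex.ofReal_mul, Real.mul_self_sqrt (by norm_num), Complex.ofReal_ofNat]
  have h0 : opA a' (controlOp OA 0) = Real.sqrt (1 / 2) • 1 := by
    change opA a' (Real.sqrt (1 / 2) • (1 : Matrix a a ℂ)) = _
    rw [opA_smul, opA, one_kronecker_one]
  have h1 : opA a' (controlOp OA 1) = Real.sqrt (1 / 2) • (opNorm OA)⁻¹ • opA a' OA := by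
    change opA a' (Real.sqrt (1 / 2) • (opNorm OA)⁻¹ • OA) = _
    rw [opA_smul, opA_smul]
  rw [trace_branchState_mul]
  simp only [Fin.sum_univ_three]
  rw [h0, h1]
  simp only [offDiag, conjTranspose_smul, (opA_isHermitian (a' := a') hOA).eq]
  simp [trace_smul, Matrix.mul_assoc]
  linear_combination ((opNorm OA : ℂ)⁻¹ * (u * (ρ * (heisenbergB U O * opA a' OA)).trace +
    (starRingEnd ℂ) u * (ρ * (opA a' OA * heisenbergB U O)).trace)) * hr

/-- Connected correlators are expectation values of `O_B ⊗ (u |0⟩⟨1| + ū |1⟩⟨0|)`. -/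
theorem trace_branchState_sub_mul {ρ : Matrix (a × a') (a × a') ℂ}
    {U : Matrix (b × b') (a × a') ℂ} (hU : Uᴴ * U = 1) {OA : Matrix a a ℂ} (hOA : OA.IsHermitian)
    (σ O : Matrix b b ℂ) (u : ℂ) :
    ((branchState ρ U (controlOp OA) - σ ⊗ₖ traceLeft (branchState ρ U (controlOp OA))) *
        (O ⊗ₖ offDiag u)).trace =
      ((1 / 2 * (opNorm OA)⁻¹ : ℝ) : ℂ) *
        (u * (ρ * (heisenbergB U O * opA a' OA)).trace +
          star u * (ρ * (opA a' OA * heisenbergB U O)).trace -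
          (u + star u) * (σ * O).trace * (ρ * opA a' OA).trace) := by
  have hH : heisenbergB U (1 : Matrix b b ℂ) = 1 := by simp [heisenbergB, hU]
  -- The marginal on W is covered by the same correlator formula with the B observable equal to 1,
  -- whose Heisenberg evolution is trivial.
  rw [Matrix.sub_mul, trace_sub, ← mul_kronecker_mul, trace_kronecker, trace_traceLeft_mul,
    trace_branchState_offDiag hOA, trace_branchState_offDiag hOA, hH, Matrix.one_mul,
    Matrix.mul_one]
  ring

theorem isState_controlState {ρ : Matrix (a × a') (a × a') ℂ} (hρ : IsState ρ)
    {U : Matrix (b × b') (a × a') ℂ} (hU : Uᴴ * U = 1) {OA : Matrix a a ℂ}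
    (hOA : OA.IsHermitian) (hOA0 : OA ≠ 0) : IsState (branchState ρ U (controlOp OA)) := by
  refine isState_branchState hρ hU ?_
  have := controlBlock_orthogonal hOA hOA0 0 0
  simpa only [controlBlock_zero, if_true] using this

/-- The entropic bound for the control coupling of `N` copies, for a general reference state `σ`
of `B` and a general phase `u`. -/
theorem correlator_le_relEntropy {N : ℕ} (hN : 1 ≤ N) {w : Type*} [Fintype w] [DecidableEq w]
    (e : w ≃ (Fin N → Fin 3)) {ρ : Matrix (a × a') (a × a') ℂ} (hρ : IsState ρ)
    {U : Matrix (b × b') (a × a') ℂ} (hU : Uᴴ * U = 1) {OA : Matrix a a ℂ}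
    (hOA : OA.IsHermitian) (hOA0 : OA ≠ 0) {OB : Matrix b b ℂ} (hOB : OB.IsHermitian)
    (hOB0 : OB ≠ 0) {σ : Matrix b b ℂ} (hσ : IsState σ) {u z : ℂ} (hu : u * star u = 1)
    (hz : z = u * (ρ * (heisenbergB U OB * opA a' OA)).trace +
          star u * (ρ * (opA a' OA * heisenbergB U OB)).trace -
          (u + star u) * (σ * OB).trace * (ρ * opA a' OA).trace) (hz0 : z.im = 0) :
    ((N * (1 / 8 * (z.re / (opNorm OA * opNorm OB)) ^ 2) : ℝ) : EReal) ≤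
      relEntropy
        ((tensorPow N (branchState ρ U (controlOp OA))).submatrix (pairEquiv b e) (pairEquiv b e))
        (tensorPow N σ ⊗ₖ traceLeft ((tensorPow N (branchState ρ U (controlOp OA))).submatrix
          (pairEquiv b e) (pairEquiv b e))) := by
  have hτ := isState_controlState hρ hU hOA hOA0
  have hA := opNorm_pos hOA0
  have hB := opNorm_pos hOB0
  rw [traceLeft_tensorPow, tensorPow_kronecker]
  have hO : (OB ⊗ₖ offDiag u).IsHermitian := by
    rw [IsHermitian, conjTranspose_kronecker, hOB.eq, (offDiag_isHermitian u).eq]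
  have h := pinsker_observable_tensorPow hN hτ (hσ.kronecker hτ.traceLeft) (pairEquiv b e) hO
    (pow_pos hB 2) (posSemidef_kronecker_offDiag hOB hu)
  rw [trace_branchState_sub_mul hU hOA, ← hz] at h
  convert h using 3
  -- Reality of z lets its real part replace its modulus. The prefactor 1/(2‖O_A‖), squared and
  -- divided by 2c with c = ‖O_B‖², produces the 1/8.
  have hzn : ‖z‖ ^ 2 = z.re ^ 2 := by
    rw [Complex.sq_norm, Complex.normSq_apply, hz0]
    ring
  rw [norm_mul, mul_pow, hzn, Complex.norm_real, Real.norm_eq_abs, sq_abs]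
  field_simp
  ring

end Correlators

end STMI

/-! ### Choice of phases and coupling: proof of the bounds -/

open STMI in
theorem theorem1 {a a' b b' : Type*} [Fintype a] [DecidableEq a] [Fintype a'] [DecidableEq a']
    [Fintype b] [DecidableEq b] [Fintype b'] [DecidableEq b']
    (ρ : Matrix (a × a') (a × a') ℂ) (hρ : STMI.IsState ρ)
    (U : Matrix (b × b') (a × a') ℂ) (hU : Uᴴ * U = 1) (hU' : U * Uᴴ = 1)
    (OA : Matrix a a ℂ) (hOA : OA.IsHermitian) (hOA0 : OA ≠ 0)
    (OB : Matrix b b ℂ) (hOB : OB.IsHermitian) (hOB0 : OB ≠ 0) :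
    (∀ N : ℕ, 1 ≤ N →
      ((1 / 8 * ((STMI.retarded ρ U OA OB).re / (STMI.opNorm OA * STMI.opNorm OB)) ^ 2 : ℝ) : EReal)
          ≤ STMI.stmi N ρ U ∧
      ((1 / 8 * ((STMI.symmetricConn ρ U OA OB).re / (STMI.opNorm OA * STMI.opNorm OB)) ^ 2 : ℝ) :
          EReal) ≤ STMI.stmi N ρ U) ∧
    -- single-copy mutual information bound, for the control-`O_A` coupling to `W = ℂ³`
    ∃ V ∈ Matrix.unitaryGroup ((Fin 1 → a) × Fin 3) ℂ,
      (∀ (x y : Fin 1 → a) (i : Fin 3), V (x, i) (y, 0) = STMI.controlOp OA i (x 0) (y 0)) ∧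
      ((1 / 8 * ((STMI.retarded ρ U OA OB).re / (STMI.opNorm OA * STMI.opNorm OB)) ^ 2 : ℝ) : EReal)
          ≤ STMI.mutualInfo (STMI.stateBW 1 ρ U V (Pi.single 0 1)) := by
  have hcol : (fun i => (controlUnitary OA).submatrix (fun x => (x, i)) (fun x => (x, 0))) =
      controlOp OA := by
    funext i
    rw [← controlBlock_zero]
    rfl
  have hτ := isState_controlState hρ hU hOA hOA0
  -- At u = -i the disconnected term carries u + ū = 0, so the reference state σ of B is arbitrary:
  -- ρ_{B,0} for J_N, the true marginal ρ_B for the mutual information.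
  have hret : ∀ σ : Matrix b b ℂ, retarded ρ U OA OB =
      -Complex.I * (ρ * (heisenbergB U OB * opA a' OA)).trace +
        star (-Complex.I) * (ρ * (opA a' OA * heisenbergB U OB)).trace -
        (-Complex.I + star (-Complex.I)) * (σ * OB).trace * (ρ * opA a' OA).trace := by
    intro σ
    simp only [retarded, Matrix.mul_sub, Matrix.trace_sub, star_neg, RCLike.star_def,
      Complex.conj_I]
    ring
  -- At u = 1 the disconnected term survives with factor 2, and σ must be ρ_{B,0} to reproduce
  -- Tr(ρ_in O_B(t)).
  have hsym : symmetricConn ρ U OA OB =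
      1 * (ρ * (heisenbergB U OB * opA a' OA)).trace +
        star 1 * (ρ * (opA a' OA * heisenbergB U OB)).trace -
        (1 + star 1) * (stateB0 ρ U * OB).trace * (ρ * opA a' OA).trace := by
    simp only [symmetricConn, Matrix.mul_add, Matrix.trace_add, star_one, trace_stateB0_mul]
    ring
  have hIu : -Complex.I * star (-Complex.I) = 1 := by simp
  have hret0 := retarded_im hρ.1.isHermitian U hOA hOB
  have hsym0 := symmetricConn_im hρ.1.isHermitian U hOA hOB
  refine ⟨fun N hN => ?_, ?_⟩
  · have key : ∀ r : ℝ, ((N * r : ℝ) : EReal) ≤ relEntropy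
        ((tensorPow N (branchState ρ U (controlOp OA))).submatrix
          (pairEquiv b finFunctionFinEquiv.symm) (pairEquiv b finFunctionFinEquiv.symm))
        (tensorPow N (stateB0 ρ U) ⊗ₖ traceLeft
          ((tensorPow N (branchState ρ U (controlOp OA))).submatrix
          (pairEquiv b finFunctionFinEquiv.symm) (pairEquiv b finFunctionFinEquiv.symm))) →
        (r : EReal) ≤ stmi N ρ U := by
      intro r hr
      rw [← hcol, ← stateBW_tensorPow ρ U (controlUnitary OA)] at hr
      have hN0 : (N : ℝ) ≠ 0 := by positivity
      have hr' : (r : EReal) = ((1 / (N : ℝ) : ℝ) : EReal) * ((N * r : ℝ) : EReal) := by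
        rw [← EReal.coe_mul]
        congr 1
        field_simp
      rw [hr', stmi]
      refine mul_le_mul_of_nonneg_left (hr.trans ?_) (EReal.coe_nonneg.mpr (by positivity))
      -- The ancilla has dimension 3^N, its basis labelled by N ternary digits; the coupling is the
      -- regrouped tensor power of the control unitary, and ψ is the image of |0…0⟩.
      refine le_iSup_of_le (3 ^ N) <| le_iSup_of_le _ <| le_iSup_of_le
        (tensorPow_submatrix_mem_unitaryGroup (controlUnitary_mem hOA hOA0) _) <|
        le_iSup_of_le _ <| le_iSup_of_le ?_ le_rfl
      simp
    have hB0 := isState_stateB0 hρ hU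
    exact ⟨key _ (correlator_le_relEntropy hN _ hρ hU hOA hOA0 hOB hOB0 hB0 hIu (hret _) hret0),
      key _ (correlator_le_relEntropy hN _ hρ hU hOA hOA0 hOB hOB0 hB0 (by simp) hsym hsym0)⟩
  · let e : Fin 3 ≃ (Fin 1 → Fin 3) := (Equiv.funUnique (Fin 1) (Fin 3)).symm
    refine ⟨(tensorPow 1 (controlUnitary OA)).submatrix (pairEquiv a e) (pairEquiv a e),
      tensorPow_submatrix_mem_unitaryGroup (controlUnitary_mem hOA hOA0) _, ?_, ?_⟩
    · intro x y i
      rw [← controlBlock_zero]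
      simp [tensorPow, controlUnitary, e]
    -- The reference state is now the marginal of the coupled state, which turns the relative
    -- entropy into the mutual information.
    · have h := correlator_le_relEntropy le_rfl e hρ hU hOA hOA0 hOB hOB0 hτ.traceRight hIu
        (hret _) hret0
      rw [← traceRight_tensorPow e, ← hcol, ← stateBW_tensorPow ρ U (controlUnitary OA)] at h
      rw [Nat.cast_one, one_mul] at h
      exact h
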